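/- **Setting.** $|\cdot|$ is the Euclidean norm and the induced matrix norm, $|f|_\infty=\sup_{t\ge0}|f(t)|$, $\bar r(M)$ is the supremum over $t\ge 0$ of the spectral radius of $M(t)$, and $M_1\le M_2$ means that $M_2-M_1$ is positive semidefinite. Let $\tau>0$ and $\sigma_0>0$ be constants, let $A:\mathbb R\to\mathbb R^{n\times n}$ and $B:[0,\infty)\to\mathbb R^n$ be bounded and continuous, with $B$ differentiable with bounded derivative. Let $\Phi_E$ be the state transition matrix of $E(t)=A(t+\tau)$, i.e. $\partial_t\Phi_E(t,s)=E(t)\Phi_E(t,s)$, $\Phi_E(s,s)=I$, and put $B_{\rm new}(t)=\Phi_E(t-\tau,t)B(t+\tau)$ for $t\ge 0$. For $\epsilon>0$ and a matrix $K\in\mathbb R^{n\times n}$ consider the closed loop system $$\dot x(t)=A(t)x(t)+B(t)u(t-\tau),\qquad u(t)=\begin{cases}0,&t<0\\ \sqrt{\tfrac{2\pi}{\epsilon}}\cos\!\big(\tfrac{2\pi}{\epsilon}t+\zeta^\top(t)K\zeta(t)\big),&t\ge0,\end{cases}$$ $$\zeta(t)=x(t)+\mathcal T(t,\zeta_t),\qquad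 \mathcal T(t,\zeta_t)=\int_{t-\tau}^t\Phi_E(t-\tau,m)B(m+\tau)u(m)\,dm ,$$ where a solution consists of continuous functions $x,\zeta$ on $[0,\infty)$, with the differential equation holding for all $t\ge 0$, $t\neq\tau$ (one-sided at $t=0$). **Assumptions.** Write $\mathcal B=B_{\rm new}$, $\bar B=|\mathcal B|_\infty$, $\bar D_B=|\dot{\mathcal B}|_\infty$, $H(t)=A(t)-\mathcal B(t)\mathcal B^\top(t)K$, $D=\mathcal B\mathcal B^\top$, and $\bar r_A=\bar r(KA+A^\top K)$. 1. $\mathcal B$ is differentiable on $[0,\infty)$, $\bar B$ and $\bar D_B$ are finite, $\bar B>0$, and $|A(t)|\le\bar A$ for all $t\ge0$, for a constant $\bar A$. 2. $K$ is (symmetric) positive definite, and there are a $C^1$ function $P:[0,\infty)\to\mathbb R^{n\times n}$ with positive definite values and positive constants $q,\underline p,\bar p,\bar{\bar p}$ such that for all $t\ge0$: $\dot P+PH+H^\top P\le -qP$, $\underline pI\le P\le\bar pI$, $|P|\le\bar p$, $|\dot P|\le\bar{\bar p}$. 3. With $$\bar M_C=\tfrac{1}{\sqrt{2\pi}}\big(|H\mathcal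 B|_\infty+|DK\mathcal B|_\infty+\bar D_B\big)+\sqrt{\tfrac{2}{\pi^3}}\,\bar A|K|\bar B^3\epsilon,\qquad \lambda=\frac{4\pi}{4\pi-\epsilon|DK|_\infty},$$ $$c_1=2\bar p\sqrt\epsilon\Big(1+\tfrac{\epsilon}{4\pi}|DK|_\infty\Big)\bar M_C,$$ $$c_2=2\bar p\Big(\tfrac{\lambda\epsilon^2}{2\pi^2}\bar B^2\bar r_A|DK|_\infty+\tfrac{\lambda\epsilon}{\pi}\bar B|K\mathcal B|_\infty|DK|_\infty+\tfrac{\lambda\epsilon}{4\pi}\big[|DKH|_\infty+|HDK|_\infty+|DKDK|_\infty\big]\Big)+\tfrac{\lambda\epsilon}{\pi}\bar p\bar B\bar D_B|K|,$$ $$c_3=2\bar p\sqrt{\tfrac{2\epsilon}{\pi}}\Big(\lambda^2|DK|_\infty|K\mathcal B|_\infty+2\lambda^2\big[1+\tfrac{\epsilon}{4\pi}|DK|_\infty\big]\bar B\bar A|K|\Big),\qquad c_4=\tfrac{2\lambda^3\epsilon\bar p}{\pi}\bar r_A|DK|_\infty,$$ $$S=\sqrt{q^2\underline p^4-4c_1(c_3+2c_4)\underline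 p^2},\quad \xi_s=\frac{2c_1\underline p^2}{q\underline p^2+S},\quad \xi_l=\frac{q\underline p^2+S}{2c_3+4c_4},\quad r_0=\frac{\xi_l-\xi_s}{\underline p^2}\Big(\frac{c_3}{2}+c_4\Big),$$ $$\mathcal L=2\bar p\Big(1+\tfrac{\epsilon}{4\pi}|DK|_\infty\Big)^2\Big(\sigma_0^2+\tfrac{\epsilon\bar B^2}{2\pi}\Big),$$ one has $\epsilon|DK|_\infty\le2\pi$, $c_1+c_3+2c_2\le\underline pq$, $4c_1(c_3+2c_4)<\underline p^2q^2$, and $\mathcal L<\xi_l$. **Theorem.** Let Assumptions 1 and 2 hold. (i) If $\epsilon>0$ satisfies Assumption 3, then for each $x_0$ with $|x_0|\le\sigma_0$ the closed loop system has a solution on $[0,\infty)$ with $x(0)=x_0$, and every such solution satisfies, for each $\xi_0\in(\max\{\xi_s,\mathcal L\},\xi_l)$ and all $t\ge0$, $$|x(t)|\le\frac{\lambda}{\sqrt{\underline p}}\sqrt{\frac{(\xi_0-\xi_s)\xi_le^{-r_0t}+\xi_s(\xi_l-\xi_0)}{(\xi_0-\xi_s)e^{-r_0t}+\xi_l-\xi_0}}+|B_{\rm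 new}|_\infty\sqrt{\frac{\epsilon}{2\pi}}+|\mathcal T(t,\zeta_t)|.$$ (ii) There are constants $c_{\mathcal T}>0$ and $d_{\mathcal T}>0$, not depending on $\epsilon$ or on the solution, such that for each $\epsilon\in(0,1)$ satisfying Assumption 3 and each solution with $|x(0)|\le\sigma_0$, $$\limsup_{t\to+\infty}|\mathcal T(t,\zeta_t)|\le c_{\mathcal T}\,\epsilon^{1/4}\quad\text{and}\quad\limsup_{t\to+\infty}|x(t)|\le d_{\mathcal T}\,\epsilon^{1/4}.$$ -/

import Mathlib

open scoped Matrix.Norms.L2Operator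

noncomputable section

/-! ### Vectors, matrices and suprema over nonnegative times

Vectors carry the Euclidean norm and matrices the corresponding operator norm. -/

/-- The Euclidean space of real `n`-tuples. -/
abbrev RVec (n : ℕ) : Type := EuclideanSpace ℝ (Fin n)

/-- Real `n × n` matrices. -/
abbrev RMat (n : ℕ) : Type := Matrix (Fin n) (Fin n) ℝ

/-- The product `M v` of a matrix and a vector. -/
abbrev act {n : ℕ} (M : RMat n) (v : RVec n) : RVec n :=
  Matrix.toEuclideanCLM (n := Fin n) (𝕜 := ℝ) M v

/-- The rank-one matrix `b bᵀ`. -/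
def outer {n : ℕ} (b : RVec n) : RMat n := Matrix.vecMulVec b.ofLp b.ofLp

/-- The supremum norm `|f|_∞` over all times `t ≥ 0`. -/
def supNorm {F : Type} [Norm F] (f : ℝ → F) : ℝ := ⨆ t : Set.Ici (0 : ℝ), ‖f t‖

/-- The supremum over `t ≥ 0` of the spectral radius of `M t`
(the largest modulus of a complex eigenvalue). -/
def rBar {n : ℕ} (M : ℝ → RMat n) : ℝ :=
  ⨆ t : Set.Ici (0 : ℝ), (spectralRadius ℂ ((M t).map (algebraMap ℝ ℂ))).toReal

/-- The derivative of a function on `[0, ∞)` (one-sided at `0`). -/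
def dot {F : Type} [NormedAddCommGroup F] [NormedSpace ℝ F] (f : ℝ → F) (t : ℝ) : F :=
  derivWithin f (Set.Ici 0) t

/-! ### State transition matrices -/

/-- `Φ` is the state transition matrix of `E`: `∂Φ(t,s)/∂t = E(t) Φ(t,s)` and `Φ(s,s) = I`. -/
def IsStateTransition {n : ℕ} (E : ℝ → RMat n) (Φ : ℝ → ℝ → RMat n) : Prop :=
  ∀ s, Φ s s = 1 ∧ ∀ t, HasDerivAt (fun r => Φ r s) (E t * Φ t s) t

/-- The terms of the Peano-Baker series. -/
def peanoBakerTerm {n : ℕ} (E : ℝ → RMat n) (s : ℝ) : ℕ → ℝ → RMat n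
  | 0, _ => 1
  | k + 1, t => ∫ r in s..t, E r * peanoBakerTerm E s k r

/-- The state transition matrix `Φ_E(t, s)`, as the sum of the Peano-Baker series. -/
def stateTransition {n : ℕ} (E : ℝ → RMat n) (t s : ℝ) : RMat n :=
  ∑' k : ℕ, peanoBakerTerm E s k t

theorem continuous_peanoBakerTerm {n : ℕ} {E : ℝ → RMat n} (hE : Continuous E) (s : ℝ) (k : ℕ) :
    Continuous (peanoBakerTerm E s k) := by
  induction k with
  | zero => exact continuous_const
  | succ k ih =>
    exact intervalIntegral.continuous_primitive
      (fun a b => (hE.mul ih).intervalIntegrable a b) s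

theorem hasDerivAt_peanoBakerTerm_succ {n : ℕ} {E : ℝ → RMat n} (hE : Continuous E) (s : ℝ)
    (k : ℕ) (t : ℝ) :
    HasDerivAt (peanoBakerTerm E s (k + 1)) (E t * peanoBakerTerm E s k t) t := by
  have hc := hE.mul (continuous_peanoBakerTerm hE s k)
  exact intervalIntegral.integral_hasDerivAt_right (hc.intervalIntegrable s t)
    (hc.stronglyMeasurableAtFilter _ _) hc.continuousAt

theorem norm_peanoBakerTerm_le {n : ℕ} {E : ℝ → RMat n} (hE : Continuous E) (s T M : ℝ)
    (hM : ∀ r, |r - s| ≤ T → ‖E r‖ ≤ M) (k : ℕ) (t : ℝ) (ht : |t - s| ≤ T) :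
    ‖peanoBakerTerm E s k t‖ ≤ ‖(1 : RMat n)‖ * (M * |t - s|) ^ k / k.factorial := by
  induction k generalizing t with
  | zero => simp [peanoBakerTerm]
  | succ k ih =>
    have hM0 : 0 ≤ M := le_trans (norm_nonneg _) (hM t ht)
    have hc := (hE.mul (continuous_peanoBakerTerm hE s k)).norm
    calc ‖∫ r in s..t, E r * peanoBakerTerm E s k r‖
        ≤ ∫ r in Set.uIoc s t, ‖E r * peanoBakerTerm E s k r‖ :=
          intervalIntegral.norm_integral_le_integral_norm_uIoc
      _ ≤ ∫ r in Set.uIoc s t,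
            (‖(1 : RMat n)‖ * M ^ (k + 1) / k.factorial) * |r - s| ^ k := by
          apply MeasureTheory.setIntegral_mono_on
          · exact (hc.integrableOn_uIoc)
          · exact Continuous.integrableOn_uIoc (by fun_prop)
          · exact measurableSet_uIoc
          · intro r hr
            have hrs : |r - s| ≤ |t - s| :=
              Set.abs_sub_left_of_mem_uIcc (Set.uIoc_subset_uIcc hr)
            have h1 := ih r (hrs.trans ht)
            calc ‖E r * peanoBakerTerm E s k r‖
                ≤ ‖E r‖ * ‖peanoBakerTerm E s k r‖ := norm_mul_le _ _
              _ ≤ M * (‖(1 : RMat n)‖ * (M * |r - s|) ^ k / k.factorial) :=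
                  mul_le_mul (hM r (hrs.trans ht)) h1 (norm_nonneg _) hM0
              _ = _ := by rw [mul_pow]; ring
      _ = ‖(1 : RMat n)‖ * (M * |t - s|) ^ (k + 1) / (k + 1).factorial := by
          rw [MeasureTheory.integral_const_mul, integral_pow_abs_sub_uIoc, Nat.factorial_succ,
            mul_pow]
          push_cast
          field_simp

/-- For continuous `E` the Peano-Baker series is the state transition matrix of `E`. -/
theorem isStateTransition_stateTransition {n : ℕ} {E : ℝ → RMat n} (hE : Continuous E) :
    IsStateTransition E (stateTransition E) := by
  intro s
  have hss : ∀ k : ℕ, k ≠ 0 → peanoBakerTerm E s k s = 0 := by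
    intro k hk
    obtain ⟨j, rfl⟩ := Nat.exists_eq_succ_of_ne_zero hk
    simp [peanoBakerTerm]
  refine ⟨?_, ?_⟩
  · unfold stateTransition
    rw [tsum_eq_single 0 hss]
    rfl
  · intro t
    obtain ⟨T, hT⟩ : ∃ T : ℝ, |t - s| < T := exists_gt _
    have hT0 : 0 < T := lt_of_le_of_lt (abs_nonneg _) hT
    obtain ⟨M, hM⟩ := (isCompact_closedBall s T).exists_bound_of_continuousOn hE.continuousOn
    have hM' : ∀ r, |r - s| ≤ T → ‖E r‖ ≤ M := fun r hr =>
      hM r (by simpa [Metric.mem_closedBall, Real.dist_eq] using hr)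
    have hM0 : 0 ≤ M := le_trans (norm_nonneg _) (hM' t hT.le)
    set u : ℕ → ℝ := fun k => ‖(1 : RMat n)‖ * (M * T) ^ k / k.factorial with hu
    have hus : Summable u := by
      have := (Real.summable_pow_div_factorial (M * T)).mul_left ‖(1 : RMat n)‖
      simpa [hu, mul_div_assoc] using this
    have hbd : ∀ k r, |r - s| ≤ T → ‖peanoBakerTerm E s k r‖ ≤ u k := by
      intro k r hr
      refine (norm_peanoBakerTerm_le hE s T M hM' k r hr).trans ?_
      have : (M * |r - s|) ^ k ≤ (M * T) ^ k :=
        pow_le_pow_left₀ (by positivity) (mul_le_mul_of_nonneg_left hr hM0) k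
      simp only [hu]
      gcongr
    have hsum : ∀ r, |r - s| ≤ T → Summable fun k => peanoBakerTerm E s k r := fun r hr =>
      Summable.of_norm_bounded hus fun k => hbd k r hr
    have hmem : ∀ {r}, r ∈ Metric.ball s T ↔ |r - s| < T := by
      intro r; simp [Metric.mem_ball, Real.dist_eq]
    have key : HasDerivAt (fun r => ∑' k : ℕ, peanoBakerTerm E s (k + 1) r)
        (∑' k : ℕ, E t * peanoBakerTerm E s k t) t := by
      refine hasDerivAt_tsum_of_isPreconnected (u := fun k => M * u k) (hus.mul_left M)
        Metric.isOpen_ball (convex_ball s T).isPreconnected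
        (fun k r _ => hasDerivAt_peanoBakerTerm_succ hE s k r) ?_
        (Metric.mem_ball_self hT0) ?_ (hmem.2 hT)
      · intro k r hr
        have hr' := (hmem.1 hr).le
        exact (norm_mul_le _ _).trans
          (mul_le_mul (hM' r hr') (hbd k r hr') (norm_nonneg _) hM0)
      · exact (summable_nat_add_iff 1).2 (hsum s (by simpa using hT0.le))
    rw [(hsum t hT.le).tsum_mul_left] at key
    have hev : (fun r => stateTransition E r s) =ᶠ[nhds t]
        fun r => 1 + ∑' k : ℕ, peanoBakerTerm E s (k + 1) r := by
      filter_upwards [Metric.isOpen_ball.mem_nhds (hmem.2 hT)] with r hr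
      exact (hsum r (hmem.1 hr).le).tsum_eq_zero_add
    exact (key.const_add 1).congr_of_eventuallyEq hev

/-! ### Data and constants of the bounded extremum seeking design -/

/-- The functions `A`, `B`, the gain `K`, and the numerical bounds of the design. -/
structure ESData (n : ℕ) where
  A : ℝ → RMat n
  B : ℝ → RVec n
  K : RMat n
  q : ℝ
  pLow : ℝ
  pBar : ℝ
  ABar : ℝ
  BBar : ℝ
  DBBar : ℝ
  deltaBar : ℝ

namespace ESData

variable {n : ℕ}

/-- `B(t) B(t)ᵀ K`. -/
def DK (d : ESData n) (t : ℝ) : RMat n := outer (d.B t) * d.K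

/-- `H(t) = A(t) - B(t) B(t)ᵀ K`. -/
def H (d : ESData n) (t : ℝ) : RMat n := d.A t - d.DK t

/-- `r̄(K A + Aᵀ K)`. -/
def rA (d : ESData n) : ℝ :=
  rBar fun t => d.K * d.A t + (d.A t).transpose * d.K

/-- The norm `|K B|_∞`. -/
def normKB (d : ESData n) : ℝ := supNorm fun t => act d.K (d.B t)

/-- The norm `|B Bᵀ K|_∞`. -/
def normDK (d : ESData n) : ℝ := supNorm d.DK

def MC (d : ESData n) (ε : ℝ) : ℝ :=
  1 / √(2 * Real.pi) *
      (supNorm (fun t => act (d.H t) (d.B t)) + supNorm (fun t => act (d.DK t) (d.B t)) + d.DBBar)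
    + √(2 / Real.pi ^ 3) * d.ABar * ‖d.K‖ * d.BBar ^ 3 * ε
    + d.BBar * d.deltaBar * √(2 * Real.pi) / ε

def lam (d : ESData n) (ε : ℝ) : ℝ := 4 * Real.pi / (4 * Real.pi - ε * d.normDK)

def c₁ (d : ESData n) (ε : ℝ) : ℝ :=
  2 * d.pBar * √ε * (1 + ε / (4 * Real.pi) * d.normDK) *
    (d.MC ε + 2 * d.BBar ^ 3 * ‖d.K‖ * d.deltaBar / √(2 * Real.pi))

def c₂ (d : ESData n) (ε : ℝ) : ℝ :=
  2 * d.pBar *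
      (d.lam ε * ε ^ 2 / (2 * Real.pi ^ 2) * d.BBar ^ 2 * d.rA * d.normDK
        + d.lam ε * ε / Real.pi * d.BBar * d.normKB * d.normDK
        + d.lam ε * ε / (4 * Real.pi) *
          (supNorm (fun t => d.DK t * d.H t) + supNorm (fun t => d.H t * d.DK t)
            + supNorm (fun t => d.DK t * d.DK t)))
    + d.lam ε * ε / Real.pi * d.pBar * d.BBar * d.DBBar * ‖d.K‖
    + 4 * d.lam ε * d.BBar ^ 2 * ‖d.K‖ * (1 + ε / (4 * Real.pi) * d.normDK) * d.deltaBar * d.pBar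

def c₃ (d : ESData n) (ε : ℝ) : ℝ :=
  2 * d.pBar * √(2 * ε / Real.pi) *
    (d.lam ε ^ 2 * d.normDK * d.normKB
      + 2 * d.lam ε ^ 2 * (1 + ε / (4 * Real.pi) * d.normDK) * d.BBar * d.ABar * ‖d.K‖)

def c₄ (d : ESData n) (ε : ℝ) : ℝ :=
  2 * d.lam ε ^ 3 * ε * d.pBar / Real.pi * d.rA * d.normDK

/-- The square root in the formulas for `ξ_s` and `ξ_l`. -/
def disc (d : ESData n) (ε : ℝ) : ℝ :=
  √(d.q ^ 2 * d.pLow ^ 4 - 4 * d.c₁ ε * (d.c₃ ε + 2 * d.c₄ ε) * d.pLow ^ 2)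

def xiS (d : ESData n) (ε : ℝ) : ℝ :=
  2 * d.c₁ ε * d.pLow ^ 2 / (d.q * d.pLow ^ 2 + d.disc ε)

def xiL (d : ESData n) (ε : ℝ) : ℝ :=
  (d.q * d.pLow ^ 2 + d.disc ε) / (2 * d.c₃ ε + 4 * d.c₄ ε)

def r₀ (d : ESData n) (ε : ℝ) : ℝ :=
  (d.xiL ε - d.xiS ε) / d.pLow ^ 2 * (d.c₃ ε / 2 + d.c₄ ε)

/-- `2 p̄ (1 + (ε/4π)|B Bᵀ K|_∞)² (σ₀² + B̄² ε/(2π))`. -/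
def initBound (d : ESData n) (σ₀ ε : ℝ) : ℝ :=
  2 * d.pBar * (1 + ε / (4 * Real.pi) * d.normDK) ^ 2 *
    (σ₀ ^ 2 + d.BBar ^ 2 * (ε / (2 * Real.pi)))

/-- The transient bound
`(λ/√p̲) √(((ξ₀-ξ_s) ξ_l e^{-r₀t} + ξ_s (ξ_l-ξ₀)) / ((ξ₀-ξ_s) e^{-r₀t} + ξ_l-ξ₀)) + B̄ √(ε/(2π))`. -/
def stateBound (d : ESData n) (ε ξ₀ t : ℝ) : ℝ :=
  d.lam ε / √d.pLow *
      √(((ξ₀ - d.xiS ε) * d.xiL ε * Real.exp (-d.r₀ ε * t) + d.xiS ε * (d.xiL ε - ξ₀)) /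
        ((ξ₀ - d.xiS ε) * Real.exp (-d.r₀ ε * t) + d.xiL ε - ξ₀))
    + d.BBar * √(ε / (2 * Real.pi))

/-- Regularity of `A` and `B` on `[0, ∞)` and the bounds `Ā`, `B̄ > 0`, `D̄_B`. -/
structure PlantBounds (d : ESData n) : Prop where
  continuousOn_A : ContinuousOn d.A (Set.Ici 0)
  differentiableOn_B : DifferentiableOn ℝ d.B (Set.Ici 0)
  BBar_pos : 0 < d.BBar
  norm_A_le : ∀ t, 0 ≤ t → ‖d.A t‖ ≤ d.ABar
  norm_B_le : ∀ t, 0 ≤ t → ‖d.B t‖ ≤ d.BBar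
  norm_dot_B_le : ∀ t, 0 ≤ t → ‖dot d.B t‖ ≤ d.DBBar

/-- `P` is a quadratic Lyapunov certificate for `Ẋ = H(t) X` with the constants of `d`; matrix
inequalities `M₁ ≤ M₂` mean that `M₂ - M₁` is positive semidefinite. -/
structure LyapunovBounds (d : ESData n) (P : ℝ → RMat n) (pBarBar : ℝ) : Prop where
  posDef_K : d.K.PosDef
  contDiffOn_P : ContDiffOn ℝ 1 P (Set.Ici 0)
  q_pos : 0 < d.q
  pLow_pos : 0 < d.pLow
  pBar_pos : 0 < d.pBar
  pBarBar_pos : 0 < pBarBar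
  decay : ∀ t, 0 ≤ t →
    (-(d.q • P t) - (dot P t + P t * d.H t + (d.H t).transpose * P t)).PosSemidef
  posDef_P : ∀ t, 0 ≤ t → (P t).PosDef
  low_le_P : ∀ t, 0 ≤ t → (P t - d.pLow • (1 : RMat n)).PosSemidef
  P_le_bar : ∀ t, 0 ≤ t → (d.pBar • (1 : RMat n) - P t).PosSemidef
  norm_P_le : ∀ t, 0 ≤ t → ‖P t‖ ≤ d.pBar
  norm_dot_P_le : ∀ t, 0 ≤ t → ‖dot P t‖ ≤ pBarBar

/-- The four smallness conditions on `ε`. -/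
structure SmallParameter (d : ESData n) (σ₀ ε : ℝ) : Prop where
  first : ε * d.normDK ≤ 2 * Real.pi
  second : d.c₁ ε + d.c₃ ε + 2 * d.c₂ ε ≤ d.pLow * d.q
  third : 4 * d.c₁ ε * (d.c₃ ε + 2 * d.c₄ ε) < d.pLow ^ 2 * d.q ^ 2
  fourth : d.initBound σ₀ ε < d.xiL ε

end ESData

/-! ### The delayed system and the reduction model control -/

/-- The transition matrix `Φ_E` of `E(t) = A(t + τ)`. -/
def delayTransition {n : ℕ} (τ : ℝ) (A : ℝ → RMat n) (t s : ℝ) : RMat n :=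
  stateTransition (fun r => A (r + τ)) t s

/-- `B_new(t) = Φ_E(t - τ, t) B(t + τ)`. -/
def BNew {n : ℕ} (τ : ℝ) (A : ℝ → RMat n) (B : ℝ → RVec n) (t : ℝ) : RVec n :=
  act (delayTransition τ A (t - τ) t) (B (t + τ))

/-- The design data with `B`, `B̄`, `D̄_B`, `δ̄` replaced by
`B_new`, `|B_new|_∞`, `|Ḃ_new|_∞`, `0`. -/
def reducedData {n : ℕ} (τ : ℝ) (A : ℝ → RMat n) (B : ℝ → RVec n) (K : RMat n)
    (q pLow pBar ABar : ℝ) : ESData n where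
  A := A
  B := BNew τ A B
  K := K
  q := q
  pLow := pLow
  pBar := pBar
  ABar := ABar
  BBar := supNorm (BNew τ A B)
  DBBar := supNorm (dot (BNew τ A B))
  deltaBar := 0

/-- The control `u(t)`: zero for `t < 0`, and `√(2π/ε) cos(2πt/ε + ζ(t)ᵀ K ζ(t))` for `t ≥ 0`. -/
def esControl {n : ℕ} (ε : ℝ) (K : RMat n) (ζ : ℝ → RVec n) (t : ℝ) : ℝ :=
  if t < 0 then 0
  else √(2 * Real.pi / ε) *
    Real.cos (2 * Real.pi / ε * t + inner ℝ (ζ t) (act K (ζ t)))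

/-- `𝒯(t, ζ_t) = ∫_{t-τ}^t Φ_E(t-τ, m) B(m+τ) u(m) dm`. -/
def reductionTerm {n : ℕ} (τ ε : ℝ) (A : ℝ → RMat n) (B : ℝ → RVec n) (K : RMat n)
    (ζ : ℝ → RVec n) (t : ℝ) : RVec n :=
  ∫ m in (t - τ)..t, esControl ε K ζ m • act (delayTransition τ A (t - τ) m) (B (m + τ))

/-- `x` solves `ẋ(t) = A(t) x(t) + B(t) u(t-τ)` on `[0, ∞)` in closed loop, where `u` is built
from `ζ(t) = x(t) + 𝒯(t, ζ_t)`. The functions `x`, `ζ` are continuous, and the differential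
equation holds at all times but `t = τ`, where `u(t-τ)` has its jump. -/
structure IsClosedLoopSolution {n : ℕ} (τ ε : ℝ) (A : ℝ → RMat n) (B : ℝ → RVec n) (K : RMat n)
    (x ζ : ℝ → RVec n) : Prop where
  continuousOn_x : ContinuousOn x (Set.Ici 0)
  continuousOn_zeta : ContinuousOn ζ (Set.Ici 0)
  zeta_eq : ∀ t, 0 ≤ t → ζ t = x t + reductionTerm τ ε A B K ζ t
  ode : ∀ t, 0 ≤ t → t ≠ τ →
    HasDerivWithinAt x (act (A t) (x t) + esControl ε K ζ (t - τ) • B t) (Set.Ici 0) t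

end

/-!
The delay is removed by the reduction `ζ = x + 𝒯(t, ζ_t)`. With `E(t) = A(t + τ)` the transition
matrix factors as `Φ_E(t, s) = Φ_E(t, 0) Z(s)` with `Z` the solution of the adjoint equation, so
that `𝒯` is differentiable away from `t = τ` with `𝒯' = A 𝒯 + B_new u(t) - B u(t - τ)`
(`hasDerivWithinAt_reductionTerm`). Hence `ζ` solves the undelayed system `ζ̇ = A ζ + B_new u`, and
every solution of the latter comes from a closed loop solution. The undelayed field is locally
Lipschitz in `ζ` with linear growth, which gives global existence.

For the undelayed system put `e = √(ε / 2π)`, `θ = t / e² + ζᵀ K ζ` and `𝓑 = B_new`. The control is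
`cos θ / e`. Subtracting the oscillation, `z = ζ - e sin(θ) 𝓑`, and then applying the near-identity
map `y = (I + (e² / 2) sin(2θ) 𝓑 𝓑ᵀ K) z` cancels the two leading oscillating terms, the second one
because `2 cos² θ = 1 + cos 2θ`. What is left is `ẏ = H y + R` with `H = A - 𝓑 𝓑ᵀ K`, where `R` is
a small polynomial in `|z| ≤ λ |y|` (`hasDerivWithinAt_averagedState`,
`norm_averaging_remainder_le`). For `W = yᵀ P y` this gives
`Ẇ ≤ -q W + c₁ |y| + c₂ |y|² + c₃ |y|³ + c₄ |y|⁴`. Absorbing the odd powers into the even ones turns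
the right-hand side into `a (W - ξ_s) (W - ξ_l)`, and comparison with the logistic equation gives the
transient bound (`ESData.IsReducedSolution.norm_le_stateBound`).

As `t → ∞` the bound on `|ζ|` tends to `(λ / √p̲) √ξ_s + |𝓑|_∞ e`, and `ξ_s ≤ 2 c₁ / q = O(√ε)`, so
`ζ` is eventually `O(ε^{1/4})`. In `𝒯` the control has amplitude `1 / e`, but integration by parts
against `e sin θ` leaves boundary terms of order `e` and an integral of order `e + |ζ|`
(`norm_reductionTerm_le`), so `𝒯`, and with it `x = ζ - 𝒯`, is eventually `O(ε^{1/4})` too.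
-/

/-! ### The averaging change of variables -/

section AveragingTransform

open Real

variable {V : Type*} [NormedAddCommGroup V] [InnerProductSpace ℝ V]

/-- The phase `t / e² + ζᵀ K ζ` of the oscillating control, where `e = √(ε / 2π)`. -/
noncomputable def oscPhase (K : V →L[ℝ] V) (e : ℝ) (ζ : ℝ → V) (t : ℝ) : ℝ :=
  (e ^ 2)⁻¹ * t + inner ℝ (ζ t) (K (ζ t))

/-- The state with its oscillation of size `e` removed: `z = ζ - e sin(θ) b`. -/
noncomputable def demodulated (K : V →L[ℝ] V) (e : ℝ) (b ζ : ℝ → V) (t : ℝ) : V :=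
  ζ t - (e * sin (oscPhase K e ζ t)) • b t

/-- The near-identity averaging change of variables `y = (I + (e²/2) sin(2θ) b bᵀ K) z`. -/
noncomputable def averagedState (K : V →L[ℝ] V) (e : ℝ) (b ζ : ℝ → V) (t : ℝ) : V :=
  demodulated K e b ζ t +
    (e ^ 2 / 2 * sin (2 * oscPhase K e ζ t) * inner ℝ (b t) (K (demodulated K e b ζ t))) • b t

/-- The part of size `e` in the derivative of the demodulated state. -/
noncomputable def demodError (A D K : V →L[ℝ] V) (θ : ℝ) (b b' ζ : V) : V :=
  sin θ • (A b - D b) - (cos (2 * θ) * sin θ) • D b - sin θ • b'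
    - (cos θ * (2 * inner ℝ (A ζ) (K ζ))) • b

/-- The deviation of the derivative of the averaged state `y` from `(A - D) y`, in terms of the
demodulated state `z`, the error `w` of its derivative and the rate `ν` of the phase beyond its
carrier frequency. -/
noncomputable def averagingRemainder (A D K : V →L[ℝ] V) (e θ ν : ℝ) (b b' z w : V) : V :=
  e • w + (e ^ 2 * ν * cos (2 * θ)) • D z
    + (e ^ 2 / 2 * sin (2 * θ)) •
      (((inner ℝ b' (K z) : ℝ) • b + (inner ℝ b (K z) : ℝ) • b')
        + (D (A z - D z) - cos (2 * θ) • D (D z) + e • D w)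
        - (A (D z) - D (D z)))

variable {K : V →L[ℝ] V} {e : ℝ} {ζ b : ℝ → V} {b' : V} {s : Set ℝ} {t : ℝ} {A D : V →L[ℝ] V}

theorem hasDerivWithinAt_oscPhase (hK : ∀ u v, inner ℝ u (K v) = inner ℝ (K u) v)
    (hζ : HasDerivWithinAt ζ (A (ζ t) + (e⁻¹ * cos (oscPhase K e ζ t)) • b t) s t) :
    HasDerivWithinAt (oscPhase K e ζ)
      ((e ^ 2)⁻¹ + (2 * inner ℝ (A (ζ t)) (K (ζ t)) +
        2 * e⁻¹ * cos (oscPhase K e ζ t) * inner ℝ (b t) (K (ζ t)))) s t := by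
  have h1 : HasDerivWithinAt (fun r => (e ^ 2)⁻¹ * r) (e ^ 2)⁻¹ s t := by
    simpa using (hasDerivWithinAt_id t s).const_mul ((e ^ 2)⁻¹)
  have h2 := hζ.inner ℝ (K.hasFDerivAt.comp_hasDerivWithinAt t hζ)
  have h3 := h1.add h2
  refine h3.congr_deriv ?_
  have hsymm : ∀ v, (inner ℝ (ζ t) (K v) : ℝ) = inner ℝ v (K (ζ t)) := fun v => by
    rw [hK, real_inner_comm]
  simp only [Function.comp, map_add, map_smul, inner_add_left, inner_add_right, inner_smul_left,
    inner_smul_right, RCLike.conj_to_real, hsymm]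
  ring

/-- The demodulated state follows `ż = A z - D z - cos(2θ) D z` up to an error of size `e`: the terms
of size `1 / e` cancel, and `2 cos² θ = 1 + cos(2θ)` splits the feedback term into its average
`D z` and an oscillation at the double frequency. -/
theorem hasDerivWithinAt_demodulated (he : e ≠ 0)
    (hK : ∀ u v, inner ℝ u (K v) = inner ℝ (K u) v)
    (hD : ∀ v, D v = (inner ℝ (b t) (K v) : ℝ) • b t)
    (hb : HasDerivWithinAt b b' s t)
    (hζ : HasDerivWithinAt ζ (A (ζ t) + (e⁻¹ * cos (oscPhase K e ζ t)) • b t) s t) :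
    HasDerivWithinAt (demodulated K e b ζ)
      (A (demodulated K e b ζ t) - D (demodulated K e b ζ t)
        - cos (2 * oscPhase K e ζ t) • D (demodulated K e b ζ t)
        + e • demodError A D K (oscPhase K e ζ t) (b t) b' (ζ t)) s t := by
  have hθ := hasDerivWithinAt_oscPhase hK hζ
  have h1 := hζ.sub ((hθ.sin.const_mul e).smul hb)
  refine h1.congr_deriv ?_
  have hz : ζ t = demodulated K e b ζ t + (e * sin (oscPhase K e ζ t)) • b t := by
    simp [demodulated]
  set θ := oscPhase K e ζ t with hθdef
  set z := demodulated K e b ζ t with hzdef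
  set Q := (inner ℝ (A (ζ t)) (K (ζ t)) : ℝ) with hQ
  unfold demodError
  rw [← hQ, hD z, hD (b t), cos_two_mul]
  have h2 : (inner ℝ (b t) (K (ζ t)) : ℝ) =
      inner ℝ (b t) (K z) + e * sin θ * inner ℝ (b t) (K (b t)) := by
    rw [hz]; simp [inner_add_right, inner_smul_right]
  rw [h2, hz]
  simp only [map_add, map_smul]
  match_scalars <;> field_simp
  ring

/-- The second change of variables cancels the oscillation `cos(2θ) D z` of the demodulated state. -/
theorem hasDerivWithinAt_averagedState (he : e ≠ 0)
    (hK : ∀ u v, inner ℝ u (K v) = inner ℝ (K u) v)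
    (hD : ∀ v, D v = (inner ℝ (b t) (K v) : ℝ) • b t)
    (hb : HasDerivWithinAt b b' s t)
    (hζ : HasDerivWithinAt ζ (A (ζ t) + (e⁻¹ * cos (oscPhase K e ζ t)) • b t) s t)
    {θ : ℝ} (hθ : θ = oscPhase K e ζ t) {z : V} (hz : z = demodulated K e b ζ t)
    {w : V} (hw : w = demodError A D K θ (b t) b' (ζ t)) {ν : ℝ}
    (hν : ν = 2 * inner ℝ (A (ζ t)) (K (ζ t)) + 2 * e⁻¹ * cos θ * inner ℝ (b t) (K (ζ t))) :
    HasDerivWithinAt (averagedState K e b ζ)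
      (A (averagedState K e b ζ t) - D (averagedState K e b ζ t)
        + averagingRemainder A D K e θ ν (b t) b' z w) s t := by
  have hz' := hasDerivWithinAt_demodulated he hK hD hb hζ
  have hθ' := hasDerivWithinAt_oscPhase hK hζ
  have h1 := hz'.add
    ((((hθ'.const_mul 2).sin.const_mul (e ^ 2 / 2)).mul
      (hb.inner ℝ (K.hasFDerivAt.comp_hasDerivWithinAt t hz'))).smul hb)
  refine h1.congr_deriv ?_
  unfold averagingRemainder
  have hy : averagedState K e b ζ t = z + (e ^ 2 / 2 * sin (2 * θ)) • D z := by
    rw [hD, smul_smul, averagedState, hz, hθ]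
  simp only [Function.comp, Pi.mul_apply]
  rw [← hθ, ← hν, hy, ← hz, ← hw]
  have e1 : ∀ v, (inner ℝ (b t) (K v) : ℝ) • b t = D v := fun v => (hD v).symm
  have e2 : e ^ 2 / 2 * (cos (2 * θ) * (2 * ((e ^ 2)⁻¹ + ν))) =
      cos (2 * θ) + e ^ 2 * ν * cos (2 * θ) := by field_simp
  rw [e2]
  set Z' := A z - D z - cos (2 * θ) • D z + e • w with hZ'
  have e3 : D Z' = D (A z - D z) - cos (2 * θ) • D (D z) + e • D w := by
    rw [hZ']; simp only [map_add, map_sub, map_smul]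
  rw [← e3, ← e1 Z', hZ', map_add A, map_add D, map_smul A, map_smul D, ← e1 z]
  module

/-- The deviation of the averaged state from the flow of `A - D` is small: every term carries a
power of `e`, and the terms are sorted by their degree in `‖z‖`. -/
theorem norm_averaging_remainder_le (he : 0 < e)
    {θ ν α ρ β δ mH mD dk kb k m₁ m₂ m₃ : ℝ} {z w b b' ζ : V} {D : V →L[ℝ] V}
    (hζ : ζ = z + (e * sin θ) • b)
    (hw : w = demodError A D K θ b b' ζ)
    (hν : ν = 2 * inner ℝ (A ζ) (K ζ) + 2 * e⁻¹ * cos θ * inner ℝ b (K ζ))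
    (hα : |2 * inner ℝ (A ζ) (K ζ)| ≤ α * ‖ζ‖ ^ 2) (hα0 : 0 ≤ α)
    (hρ : |2 * inner ℝ (A ζ) (K ζ)| ≤ ρ * ‖ζ‖ ^ 2) (hρ0 : 0 ≤ ρ)
    (hβ : ‖b‖ ≤ β) (hδ : ‖b'‖ ≤ δ)
    (hmH : ‖A b - D b‖ ≤ mH) (hmD : ‖D b‖ ≤ mD)
    (hdk : ∀ v, ‖D v‖ ≤ dk * ‖v‖) (hdk0 : 0 ≤ dk)
    (hkb : |inner ℝ b (K ζ)| ≤ kb * ‖ζ‖) (hkb0 : 0 ≤ kb) (hk : ∀ v, ‖K v‖ ≤ k * ‖v‖)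
    (h₁ : ‖D (A z - D z)‖ ≤ m₁ * ‖z‖) (h₂ : ‖A (D z) - D (D z)‖ ≤ m₂ * ‖z‖)
    (h₃ : ‖D (D z)‖ ≤ m₃ * ‖z‖) :
    ‖averagingRemainder A D K e θ ν b b' z w‖ ≤
      (1 + e ^ 2 / 2 * dk) * (e * (mH + mD + δ + β * (α * (2 * ‖z‖ ^ 2 + 2 * β ^ 2 * e ^ 2))))
      + (e ^ 2 * ρ * (2 * ‖z‖ ^ 2 + 2 * β ^ 2 * e ^ 2) + 2 * e * kb * (‖z‖ + β * e)) * dk * ‖z‖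
      + e ^ 2 / 2 * (2 * β * δ * k + (m₁ + m₂ + m₃)) * ‖z‖ := by
  have hs := abs_sin_le_one θ
  have hc := abs_cos_le_one θ
  have hs2 := abs_sin_le_one (2 * θ)
  have hc2 := abs_cos_le_one (2 * θ)
  have hβ0 : 0 ≤ β := (norm_nonneg _).trans hβ
  have hδ0 : 0 ≤ δ := (norm_nonneg _).trans hδ
  have hsm : ∀ {c C : ℝ} {v : V}, |c| ≤ 1 → ‖v‖ ≤ C → ‖c • v‖ ≤ C := by
    intro c C v hc hv
    rw [norm_smul, Real.norm_eq_abs]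
    exact (mul_le_of_le_one_left (norm_nonneg _) hc).trans hv
  have hζn : ‖ζ‖ ≤ ‖z‖ + β * e := by
    rw [hζ]
    refine (norm_add_le _ _).trans (add_le_add le_rfl ?_)
    rw [norm_smul, Real.norm_eq_abs, abs_mul, abs_of_pos he]
    calc e * |sin θ| * ‖b‖ ≤ e * 1 * β := by gcongr
      _ = β * e := by ring
  have hζ2 : ‖ζ‖ ^ 2 ≤ 2 * ‖z‖ ^ 2 + 2 * β ^ 2 * e ^ 2 := by
    have := pow_le_pow_left₀ (norm_nonneg _) hζn 2
    nlinarith [sq_nonneg (‖z‖ - β * e)]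
  have hwn : ‖w‖ ≤ mH + mD + δ + β * (α * (2 * ‖z‖ ^ 2 + 2 * β ^ 2 * e ^ 2)) := by
    rw [hw]
    unfold demodError
    have a1 := hsm hs hmH
    have a2 : ‖(cos (2 * θ) * sin θ) • D b‖ ≤ mD := by
      refine hsm ?_ hmD
      rw [abs_mul]
      exact mul_le_one₀ hc2 (abs_nonneg _) hs
    have a3 := hsm hs hδ
    have a4 : ‖(cos θ * (2 * inner ℝ (A ζ) (K ζ))) • b‖ ≤
        β * (α * (2 * ‖z‖ ^ 2 + 2 * β ^ 2 * e ^ 2)) := by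
      rw [mul_smul]
      refine hsm hc ?_
      rw [norm_smul, Real.norm_eq_abs, mul_comm β]
      gcongr
      exact hα.trans (by gcongr)
    calc _ ≤ _ := norm_sub_le _ _
      _ ≤ _ := add_le_add (norm_sub_le _ _) le_rfl
      _ ≤ _ := add_le_add (add_le_add (norm_sub_le _ _) le_rfl) le_rfl
      _ ≤ _ := by linarith
  set w₀ := mH + mD + δ + β * (α * (2 * ‖z‖ ^ 2 + 2 * β ^ 2 * e ^ 2)) with hw₀
  have hνn : e ^ 2 * |ν| ≤
      e ^ 2 * ρ * (2 * ‖z‖ ^ 2 + 2 * β ^ 2 * e ^ 2) + 2 * e * kb * (‖z‖ + β * e) := by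
    have b1 : |ν| ≤ ρ * (2 * ‖z‖ ^ 2 + 2 * β ^ 2 * e ^ 2) + 2 * e⁻¹ * (kb * (‖z‖ + β * e)) := by
      rw [hν]
      refine (abs_add_le _ _).trans (add_le_add (hρ.trans (by gcongr)) ?_)
      rw [abs_mul, abs_mul, abs_of_pos (by positivity : 0 < 2 * e⁻¹)]
      calc 2 * e⁻¹ * |cos θ| * |inner ℝ b (K ζ)| ≤ 2 * e⁻¹ * 1 * (kb * (‖z‖ + β * e)) := by
            gcongr
            exact hkb.trans (by gcongr)
        _ = _ := by ring
    refine (mul_le_mul_of_nonneg_left b1 (sq_nonneg e)).trans (le_of_eq ?_)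
    field_simp
  have t1 : ‖e • w‖ ≤ e * w₀ := by
    rw [norm_smul, Real.norm_eq_abs, abs_of_pos he]; gcongr
  have t2 : ‖(e ^ 2 * ν * cos (2 * θ)) • D z‖ ≤
      (e ^ 2 * ρ * (2 * ‖z‖ ^ 2 + 2 * β ^ 2 * e ^ 2) + 2 * e * kb * (‖z‖ + β * e)) * dk * ‖z‖ := by
    rw [mul_comm, mul_smul]
    refine hsm hc2 ?_
    rw [norm_smul, Real.norm_eq_abs, abs_mul, abs_of_pos (by positivity : 0 < e ^ 2), mul_assoc _ dk]
    have := hdk z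
    gcongr
  have t3 : ‖((inner ℝ b' (K z) : ℝ) • b + (inner ℝ b (K z) : ℝ) • b')
              + (D (A z - D z) - cos (2 * θ) • D (D z) + e • D w)
              - (A (D z) - D (D z))‖ ≤ 2 * β * δ * k * ‖z‖ + (m₁ + m₂ + m₃) * ‖z‖
                + e * dk * w₀ := by
    have hkz := hk z
    have hkz0 : 0 ≤ k * ‖z‖ := (norm_nonneg _).trans hkz
    have c1 : ‖(inner ℝ b' (K z) : ℝ) • b‖ ≤ β * δ * (k * ‖z‖) := by
      rw [norm_smul]
      calc _ ≤ (‖b'‖ * ‖K z‖) * ‖b‖ := by gcongr; exact norm_inner_le_norm _ _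
        _ ≤ (δ * (k * ‖z‖)) * β := by gcongr
        _ = _ := by ring
    have c2 : ‖(inner ℝ b (K z) : ℝ) • b'‖ ≤ β * δ * (k * ‖z‖) := by
      rw [norm_smul]
      calc _ ≤ (‖b‖ * ‖K z‖) * ‖b'‖ := by gcongr; exact norm_inner_le_norm _ _
        _ ≤ (β * (k * ‖z‖)) * δ := by gcongr
        _ = _ := by ring
    have c3 := hsm hc2 h₃
    have c4 : ‖e • D w‖ ≤ e * dk * w₀ := by
      rw [norm_smul, Real.norm_eq_abs, abs_of_pos he, mul_assoc]
      have := (hdk w).trans (mul_le_mul_of_nonneg_left hwn hdk0)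
      gcongr
    have c5 := (norm_add_le (D (A z - D z) - cos (2 * θ) • D (D z)) (e • D w)).trans
      (add_le_add ((norm_sub_le _ _).trans (add_le_add h₁ c3)) c4)
    have c6 := (norm_add_le ((inner ℝ b' (K z) : ℝ) • b) ((inner ℝ b (K z) : ℝ) • b')).trans
      (add_le_add c1 c2)
    refine (norm_sub_le _ _).trans ((add_le_add ((norm_add_le _ _).trans (add_le_add c6 c5))
      h₂).trans (le_of_eq ?_))
    ring
  have t4 : ‖(e ^ 2 / 2 * sin (2 * θ)) •
            (((inner ℝ b' (K z) : ℝ) • b + (inner ℝ b (K z) : ℝ) • b')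
              + (D (A z - D z) - cos (2 * θ) • D (D z) + e • D w)
              - (A (D z) - D (D z)))‖ ≤ e ^ 2 / 2 * (2 * β * δ * k * ‖z‖ + (m₁ + m₂ + m₃) * ‖z‖
                + e * dk * w₀) := by
    rw [mul_comm, mul_smul]
    refine hsm hs2 ?_
    rw [norm_smul, Real.norm_eq_abs, abs_of_pos (by positivity : 0 < e ^ 2 / 2)]
    gcongr
  refine norm_add₃_le.trans ((add_le_add (add_le_add t1 t2) t4).trans (le_of_eq ?_))
  ring

end AveragingTransform

/-! ### Comparison with the logistic equation -/

section Comparison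

open Real

/-- For `ξs < ξ₀ < ξl`, the solution of the logistic equation `ẇ = a (w - ξs) (w - ξl)`, `w 0 = ξ₀`, for
`r = a (ξl - ξs)`. -/
noncomputable def logisticCurve (ξs ξl ξ₀ r t : ℝ) : ℝ :=
  ((ξ₀ - ξs) * ξl * exp (-r * t) + ξs * (ξl - ξ₀)) / ((ξ₀ - ξs) * exp (-r * t) + ξl - ξ₀)

theorem logisticCurve_denom_pos {ξs ξl ξ₀ : ℝ} (hs : ξs < ξ₀) (hl : ξ₀ < ξl) (r t : ℝ) :
    0 < (ξ₀ - ξs) * exp (-r * t) + ξl - ξ₀ := by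
  have := mul_pos (sub_pos.2 hs) (exp_pos (-r * t))
  linarith

theorem logisticCurve_zero {ξs ξl ξ₀ : ℝ} (h : ξs < ξl) (r : ℝ) :
    logisticCurve ξs ξl ξ₀ r 0 = ξ₀ := by
  have : ξl - ξs ≠ 0 := (sub_pos.2 h).ne'
  simp only [logisticCurve, mul_zero, exp_zero, mul_one]
  rw [div_eq_iff (by intro h0; apply this; linarith)]
  ring

theorem hasDerivAt_logisticCurve {ξs ξl ξ₀ : ℝ} (hs : ξs < ξ₀) (hl : ξ₀ < ξl) (r t : ℝ) :
    HasDerivAt (logisticCurve ξs ξl ξ₀ r)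
      (-r * ((ξ₀ - ξs) * exp (-r * t) * (ξl - ξ₀) * (ξl - ξs))
        / ((ξ₀ - ξs) * exp (-r * t) + ξl - ξ₀) ^ 2) t := by
  have hE : HasDerivAt (fun t => exp (-r * t)) (exp (-r * t) * (-r * 1)) t :=
    ((hasDerivAt_id t).const_mul (-r)).exp
  have h1 := ((hE.const_mul ((ξ₀ - ξs) * ξl)).add_const (ξs * (ξl - ξ₀))).div
    (((hE.const_mul (ξ₀ - ξs)).add_const ξl).sub_const ξ₀)
    (logisticCurve_denom_pos hs hl r t).ne'
  refine h1.congr_deriv ?_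
  congr 1
  ring

/-- Comparison with the logistic equation. The differential inequality is not strict, so the curve
is first compared with logistic curves of slower rates `r' < r`. -/
theorem le_logisticCurve {W W' : ℝ → ℝ} {a ξs ξl ξ₀ : ℝ} (hs : ξs < ξ₀)
    (hl : ξ₀ < ξl) (hW0 : W 0 ≤ ξ₀)
    (hW : ∀ t, 0 ≤ t → HasDerivWithinAt W (W' t) (Set.Ici 0) t)
    (hW' : ∀ t, 0 ≤ t → W' t ≤ a * (W t - ξs) * (W t - ξl)) {t : ℝ} (ht : 0 ≤ t) :
    W t ≤ logisticCurve ξs ξl ξ₀ (a * (ξl - ξs)) t := by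
  have key : ∀ r < a * (ξl - ξs), W t ≤ logisticCurve ξs ξl ξ₀ r t := by
    intro r hr
    refine image_le_of_deriv_right_lt_deriv_boundary' (f := W) (f' := W') (a := 0) (b := t)
      (B := logisticCurve ξs ξl ξ₀ r) (fun x hx => (hW x hx.1).continuousWithinAt.mono
        Set.Icc_subset_Ici_self) (fun x hx => (hW x hx.1).mono (Set.Ici_subset_Ici.2 hx.1)) ?_
      (fun x _ => (hasDerivAt_logisticCurve hs hl r x).continuousAt.continuousWithinAt)
      (fun x _ => (hasDerivAt_logisticCurve hs hl r x).hasDerivWithinAt) ?_ ⟨ht, le_rfl⟩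
    · rwa [logisticCurve_zero (hs.trans hl)]
    · intro x hx hxW
      refine (hW' x hx.1).trans_lt ?_
      have hd := logisticCurve_denom_pos hs hl r x
      have e1 : a * (W x - ξs) * (W x - ξl) =
          -(a * (ξl - ξs)) * ((ξ₀ - ξs) * exp (-r * x) * (ξl - ξ₀) * (ξl - ξs))
            / ((ξ₀ - ξs) * exp (-r * x) + ξl - ξ₀) ^ 2 := by
        have e2 : W x - ξs = (ξ₀ - ξs) * exp (-r * x) * (ξl - ξs)
            / ((ξ₀ - ξs) * exp (-r * x) + ξl - ξ₀) := by
          rw [hxW, logisticCurve, div_sub' hd.ne']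
          congr 1
          ring
        have e3 : W x - ξl = -((ξl - ξ₀) * (ξl - ξs))
            / ((ξ₀ - ξs) * exp (-r * x) + ξl - ξ₀) := by
          rw [hxW, logisticCurve, div_sub' hd.ne']
          congr 1
          ring
        rw [e2, e3, mul_assoc, div_mul_div_comm, ← sq, ← mul_div_assoc]
        congr 1
        ring
      rw [e1]
      have h0 : 0 < (ξ₀ - ξs) * exp (-r * x) * (ξl - ξ₀) * (ξl - ξs) :=
        mul_pos (mul_pos (mul_pos (sub_pos.2 hs) (exp_pos _)) (sub_pos.2 hl))
          (sub_pos.2 (hs.trans hl))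
      gcongr
  have hcont : ContinuousAt (fun r => logisticCurve ξs ξl ξ₀ r t) (a * (ξl - ξs)) := by
    unfold logisticCurve
    exact ContinuousAt.div (by fun_prop) (by fun_prop) (logisticCurve_denom_pos hs hl _ t).ne'
  exact ge_of_tendsto (hcont.tendsto.mono_left (nhdsWithin_le_nhds (s := Set.Iio _)))
    (Filter.eventually_of_mem self_mem_nhdsWithin key)

theorem tendsto_logisticCurve {ξs ξl ξ₀ r : ℝ} (hl : ξ₀ < ξl) (hr : 0 < r) :
    Filter.Tendsto (logisticCurve ξs ξl ξ₀ r) Filter.atTop (nhds ξs) := by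
  have hE : Filter.Tendsto (fun t => exp (-r * t)) Filter.atTop (nhds 0) :=
    tendsto_exp_atBot.comp (Filter.tendsto_id.const_mul_atTop_of_neg (neg_lt_zero.2 hr))
  have h := (((hE.const_mul ((ξ₀ - ξs) * ξl)).add_const (ξs * (ξl - ξ₀))).div
    (((hE.const_mul (ξ₀ - ξs)).add_const ξl).sub_const ξ₀)
    (by rw [mul_zero, zero_add]; exact (sub_pos.2 hl).ne'))
  rwa [mul_zero, mul_zero, zero_add, zero_add, mul_div_cancel_right₀ _ (sub_pos.2 hl).ne'] at h

end Comparison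

/-! ### Quadratic Lyapunov functions -/

section Lyapunov

variable {V : Type*} [NormedAddCommGroup V] [InnerProductSpace ℝ V]

/-- Derivative of the quadratic Lyapunov function `⟪y, P y⟫` along `ẏ = H y + R`. -/
theorem exists_hasDerivWithinAt_quadratic_le {P : ℝ → V →L[ℝ] V} {P' H : V →L[ℝ] V} {y : ℝ → V}
    {R : V} {s : Set ℝ} {t q p : ℝ} (hP : HasDerivWithinAt P P' s t)
    (hsymm : ∀ u v, inner ℝ u (P t v) = inner ℝ (P t u) v)
    (hdecay : ∀ v, inner ℝ v (P' v) + 2 * inner ℝ (P t v) (H v) ≤ -q * inner ℝ v (P t v))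
    (hp : ∀ v, ‖P t v‖ ≤ p * ‖v‖) (hy : HasDerivWithinAt y (H (y t) + R) s t) :
    ∃ W', HasDerivWithinAt (fun r => inner ℝ (y r) (P r (y r))) W' s t ∧
      W' ≤ -q * inner ℝ (y t) (P t (y t)) + 2 * p * ‖y t‖ * ‖R‖ := by
  refine ⟨_, hy.inner ℝ (hP.clm_apply hy), ?_⟩
  have h1 := hdecay (y t)
  have h2 : (inner ℝ (P t (y t)) R : ℝ) ≤ p * ‖y t‖ * ‖R‖ :=
    (real_inner_le_norm _ _).trans (mul_le_mul_of_nonneg_right (hp _) (norm_nonneg _))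
  have h3 : (inner ℝ (H (y t) + R) (P t (y t)) : ℝ) =
      inner ℝ (P t (y t)) (H (y t)) + inner ℝ (P t (y t)) R := by
    rw [real_inner_comm, inner_add_right]
  rw [h3, inner_add_right, map_add, inner_add_right, hsymm, hsymm]
  linarith

/-- The quartic differential inequality for the Lyapunov function, with the odd powers absorbed
into the even ones, has the logistic form. -/
theorem quartic_le_logistic {q pLow c₁ c₂ c₃ c₄ S W Y : ℝ} (hp : 0 < pLow) (hc₁ : 0 ≤ c₁)
    (hc₃ : 0 ≤ c₃) (hc : 0 < c₃ + 2 * c₄) (hYW : pLow * Y ^ 2 ≤ W)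
    (hsum : c₁ + c₃ + 2 * c₂ ≤ pLow * q) (hq : 0 < q) (hS0 : 0 ≤ S)
    (hS : S ^ 2 = q ^ 2 * pLow ^ 4 - 4 * c₁ * (c₃ + 2 * c₄) * pLow ^ 2) :
    -q * W + (c₁ * Y + c₂ * Y ^ 2 + c₃ * Y ^ 3 + c₄ * Y ^ 4) ≤
      (c₃ / 2 + c₄) / pLow ^ 2 * (W - 2 * c₁ * pLow ^ 2 / (q * pLow ^ 2 + S)) *
        (W - (q * pLow ^ 2 + S) / (2 * c₃ + 4 * c₄)) := by
  have hd : 0 < q * pLow ^ 2 + S := by positivity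
  have hc' : 2 * c₃ + 4 * c₄ ≠ 0 := by linarith
  have e1 : (c₃ / 2 + c₄) / pLow ^ 2 * (W - 2 * c₁ * pLow ^ 2 / (q * pLow ^ 2 + S)) *
        (W - (q * pLow ^ 2 + S) / (2 * c₃ + 4 * c₄)) =
      (c₃ / 2 + c₄) * (W / pLow) ^ 2 - q / 2 * W + c₁ / 2 := by
    -- the smaller root is written with the conjugate `q p² - S` of the denominator
    have e2 : 2 * c₁ * pLow ^ 2 / (q * pLow ^ 2 + S) =
        (q * pLow ^ 2 - S) / (2 * c₃ + 4 * c₄) := by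
      rw [div_eq_div_iff hd.ne' hc']
      linear_combination hS
    have e3 : 2 * c₃ + 4 * c₄ = 4 * (c₃ / 2 + c₄) := by ring
    have hg : c₃ / 2 + c₄ ≠ 0 := by intro h; apply hc'; linarith
    have hS' : S ^ 2 = q ^ 2 * pLow ^ 4 - 8 * c₁ * (c₃ / 2 + c₄) * pLow ^ 2 := by rw [hS]; ring
    rw [e2, e3]
    generalize c₃ / 2 + c₄ = g at hg hS' ⊢
    field_simp
    linear_combination (-2) * hS'
  rw [e1]
  have hY2 : Y ^ 2 ≤ W / pLow := by rw [le_div_iff₀ hp]; linarith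
  have hW : W / pLow * pLow = W := by field_simp
  have hY4 : Y ^ 4 ≤ (W / pLow) ^ 2 := by
    have := pow_le_pow_left₀ (sq_nonneg Y) hY2 2
    calc Y ^ 4 = (Y ^ 2) ^ 2 := by ring
      _ ≤ _ := this
  have b1 : c₁ * Y ≤ c₁ * ((1 + Y ^ 2) / 2) :=
    mul_le_mul_of_nonneg_left (by nlinarith [sq_nonneg (Y - 1)]) hc₁
  have b3 : c₃ * Y ^ 3 ≤ c₃ * ((Y ^ 2 + Y ^ 4) / 2) :=
    mul_le_mul_of_nonneg_left (by nlinarith [sq_nonneg (Y ^ 2 - Y), sq_nonneg Y]) hc₃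
  have b4 : (c₃ / 2 + c₄) * Y ^ 4 ≤ (c₃ / 2 + c₄) * (W / pLow) ^ 2 :=
    mul_le_mul_of_nonneg_left hY4 (by linarith)
  have b2 : (c₁ / 2 + c₃ / 2 + c₂) * Y ^ 2 ≤ pLow * q / 2 * (W / pLow) :=
    (mul_le_mul_of_nonneg_right (by linarith) (sq_nonneg Y)).trans
      (mul_le_mul_of_nonneg_left hY2 (by positivity))
  have e3 : pLow * q / 2 * (W / pLow) = q / 2 * W := by field_simp
  linarith

/-- The averaging remainder, multiplied by `2 p Y`, as a quartic polynomial in `Y`. -/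
theorem averaging_remainder_le_quartic {p e dk kb w₀ σ α ρ β m lam Z Y : ℝ} (hp : 0 ≤ p)
    (he : 0 ≤ e) (hdk : 0 ≤ dk) (hkb : 0 ≤ kb) (hα : 0 ≤ α) (hρ : 0 ≤ ρ) (hβ : 0 ≤ β) (hm : 0 ≤ m)
    (hσ : 0 ≤ σ) (hY : 0 ≤ Y) (hZ : 0 ≤ Z) (hZY : Z ≤ lam * Y) :
    2 * p * Y * (σ * (e * (w₀ + β * (α * (2 * Z ^ 2 + 2 * β ^ 2 * e ^ 2))))
      + (e ^ 2 * ρ * (2 * Z ^ 2 + 2 * β ^ 2 * e ^ 2) + 2 * e * kb * (Z + β * e)) * dk * Z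
      + e ^ 2 / 2 * m * Z) ≤
      2 * p * (σ * (e * (w₀ + β * α * (2 * β ^ 2 * e ^ 2)))) * Y
      + 2 * p * lam * (2 * e ^ 4 * ρ * β ^ 2 * dk + 2 * e ^ 2 * kb * β * dk + e ^ 2 / 2 * m) * Y ^ 2
      + 2 * p * lam ^ 2 * (2 * e * kb * dk + σ * e * β * α * 2) * Y ^ 3
      + 2 * p * lam ^ 3 * (2 * e ^ 2 * ρ * dk) * Y ^ 4 := by
  have hl : 0 ≤ lam * Y := hZ.trans hZY
  have h1 : (2 * e ^ 4 * ρ * β ^ 2 * dk + 2 * e ^ 2 * kb * β * dk + e ^ 2 / 2 * m) * Z ≤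
      (2 * e ^ 4 * ρ * β ^ 2 * dk + 2 * e ^ 2 * kb * β * dk + e ^ 2 / 2 * m) * (lam * Y) := by
    gcongr
  have h2 : (2 * e * kb * dk + σ * e * β * α * 2) * Z ^ 2 ≤
      (2 * e * kb * dk + σ * e * β * α * 2) * (lam * Y) ^ 2 := by gcongr
  have h3 : (2 * e ^ 2 * ρ * dk) * Z ^ 3 ≤ (2 * e ^ 2 * ρ * dk) * (lam * Y) ^ 3 := by gcongr
  have h4 := mul_le_mul_of_nonneg_left (add_le_add (add_le_add h1 h2) h3)
    (by positivity : 0 ≤ 2 * p * Y)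
  linarith

end Lyapunov

/-! ### Matrices acting on the Euclidean space -/

section MatrixBounds

variable {n : ℕ}

theorem act_mul (M N : RMat n) (v : RVec n) : act (M * N) v = act M (act N v) := by
  simp [act]

theorem act_neg (M : RMat n) (v : RVec n) : act (-M) v = -act M v := by
  simp [act]

theorem act_sub (M N : RMat n) (v : RVec n) : act (M - N) v = act M v - act N v := by
  simp [act]

theorem act_add (M N : RMat n) (v : RVec n) : act (M + N) v = act M v + act N v := by
  simp [act]

theorem act_vec_add (M : RMat n) (u v : RVec n) : act M (u + v) = act M u + act M v :=
  map_add (Matrix.toEuclideanCLM (n := Fin n) (𝕜 := ℝ) M) u v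

theorem act_vec_sub (M : RMat n) (u v : RVec n) : act M (u - v) = act M u - act M v :=
  map_sub (Matrix.toEuclideanCLM (n := Fin n) (𝕜 := ℝ) M) u v

theorem act_vec_smul (M : RMat n) (c : ℝ) (v : RVec n) : act M (c • v) = c • act M v :=
  map_smul (Matrix.toEuclideanCLM (n := Fin n) (𝕜 := ℝ) M) c v

theorem act_one (v : RVec n) : act (1 : RMat n) v = v := by
  simp [act]

theorem norm_act_le (M : RMat n) (v : RVec n) : ‖act M v‖ ≤ ‖M‖ * ‖v‖ := by
  rw [← Matrix.l2_opNorm_toEuclideanCLM]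
  exact ContinuousLinearMap.le_opNorm _ _

theorem inner_act (M : RMat n) (u v : RVec n) :
    (inner ℝ u (act M v) : ℝ) = u.ofLp ⬝ᵥ M.mulVec v.ofLp := by
  rw [EuclideanSpace.inner_eq_star_dotProduct, Matrix.ofLp_toEuclideanCLM, star_trivial,
    dotProduct_comm]

theorem inner_act_transpose (M : RMat n) (u v : RVec n) :
    (inner ℝ u (act M.transpose v) : ℝ) = inner ℝ (act M u) v := by
  rw [real_inner_comm v, inner_act, inner_act, Matrix.mulVec_transpose,
    dotProduct_comm, ← Matrix.dotProduct_mulVec]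

theorem inner_act_comm_of_isHermitian {M : RMat n} (hM : M.IsHermitian) (u v : RVec n) :
    (inner ℝ u (act M v) : ℝ) = inner ℝ (act M u) v := by
  rw [← inner_act_transpose, ← Matrix.conjTranspose_eq_transpose_of_trivial, hM.eq]

theorem inner_act_nonneg {M : RMat n} (hM : M.PosSemidef) (v : RVec n) :
    0 ≤ (inner ℝ v (act M v) : ℝ) := by
  rw [inner_act]
  simpa using hM.dotProduct_mulVec_nonneg v.ofLp

theorem act_outer_mul (b : RVec n) (K : RMat n) (v : RVec n) :
    act (outer b * K) v = (inner ℝ b (act K v) : ℝ) • b := by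
  rw [act_mul]
  apply (WithLp.ofLp_injective 2)
  ext i
  rw [Matrix.ofLp_toEuclideanCLM, outer, Matrix.vecMulVec_mulVec, inner_act]
  simp [mul_comm]

theorem norm_outer_mul_le (b : RVec n) (K : RMat n) : ‖outer b * K‖ ≤ ‖b‖ ^ 2 * ‖K‖ := by
  rw [← Matrix.l2_opNorm_toEuclideanCLM]
  refine ContinuousLinearMap.opNorm_le_bound _ (by positivity) fun v => ?_
  change ‖act (outer b * K) v‖ ≤ _
  rw [act_outer_mul, norm_smul]
  calc ‖(inner ℝ b (act K v) : ℝ)‖ * ‖b‖ ≤ (‖b‖ * (‖K‖ * ‖v‖)) * ‖b‖ := by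
        gcongr
        exact (norm_inner_le_norm _ _).trans (by gcongr; exact norm_act_le _ _)
    _ = _ := by ring

theorem norm_transpose_eq (M : RMat n) : ‖M.transpose‖ = ‖M‖ := by
  rw [← Matrix.conjTranspose_eq_transpose_of_trivial, Matrix.l2_opNorm_conjTranspose]

/-- The operator norm of a real matrix does not decrease when the scalars are extended to `ℂ`. -/
theorem norm_act_le_norm_map (M : RMat n) (v : RVec n) :
    ‖act M v‖ ≤ ‖M.map (algebraMap ℝ ℂ)‖ * ‖v‖ := by
  set J : RVec n → EuclideanSpace ℂ (Fin n) := fun w => WithLp.toLp 2 fun i => (w i : ℂ) with hJ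
  have hn : ∀ w, ‖J w‖ = ‖w‖ := fun w => by
    simp [hJ, EuclideanSpace.norm_eq]
  have hM : J (act M v) = Matrix.toEuclideanCLM (n := Fin n) (𝕜 := ℂ)
      (M.map (algebraMap ℝ ℂ)) (J v) := by
    apply (WithLp.ofLp_injective 2)
    ext i
    simp [hJ, act, Matrix.mulVec, dotProduct]
  rw [← hn, hM, ← hn v, ← Matrix.l2_opNorm_toEuclideanCLM]
  exact ContinuousLinearMap.le_opNorm _ _

/-- The spectral radius bounds a quadratic form because the complexified matrix is self-adjoint, so
that its spectral radius is its operator norm. -/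
theorem abs_inner_act_le_spectralRadius {M : RMat n} (hM : M.IsHermitian) (v : RVec n) :
    |inner ℝ v (act M v)| ≤ (spectralRadius ℂ (M.map (algebraMap ℝ ℂ))).toReal * ‖v‖ ^ 2 := by
  have hsa : IsSelfAdjoint (M.map (algebraMap ℝ ℂ)) := by
    refine Matrix.IsHermitian.map hM _ fun x => by simp
  rw [hsa.spectralRadius_eq_nnnorm]
  calc |inner ℝ v (act M v)| ≤ ‖v‖ * ‖act M v‖ := abs_real_inner_le_norm _ _
    _ ≤ ‖v‖ * (‖M.map (algebraMap ℝ ℂ)‖ * ‖v‖) := by gcongr; exact norm_act_le_norm_map M v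
    _ = _ := by simp; ring

/-- Spectral radii of symmetric matrices are bounded by their norms; only this makes the supremum
`rBar` an actual upper bound. -/
theorem exists_spectralRadius_le (n : ℕ) : ∃ C : ℝ, ∀ M : RMat n, M.IsHermitian →
    (spectralRadius ℂ (M.map (algebraMap ℝ ℂ))).toReal ≤ C * ‖M‖ := by
  let f : RMat n →ₗ[ℝ] Matrix (Fin n) (Fin n) ℂ := (Algebra.linearMap ℝ ℂ).mapMatrix
  let g := f.toContinuousLinearMap
  refine ⟨‖g‖, fun M hM => ?_⟩
  have hsa : IsSelfAdjoint (M.map (algebraMap ℝ ℂ)) :=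
    Matrix.IsHermitian.map hM _ fun x => by simp
  rw [hsa.spectralRadius_eq_nnnorm]
  exact g.le_opNorm M

/-- Boundedness is needed here: the supremum of an unbounded family of reals is the junk value `0`. -/
theorem le_supNorm {F : Type} [Norm F] {f : ℝ → F} {C : ℝ} (h : ∀ t, 0 ≤ t → ‖f t‖ ≤ C) {t : ℝ}
    (ht : 0 ≤ t) : ‖f t‖ ≤ supNorm f :=
  le_ciSup (f := fun t : Set.Ici (0 : ℝ) => ‖f t‖) ⟨C, by rintro _ ⟨s, rfl⟩; exact h s s.2⟩ ⟨t, ht⟩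

theorem supNorm_nonneg {F : Type} [SeminormedAddGroup F] (f : ℝ → F) : 0 ≤ supNorm f :=
  Real.iSup_nonneg fun _ => norm_nonneg _

end MatrixBounds

/-! ### The constants of the design -/

section Design

open Real

/-- The amplitude `e = √(ε / 2π)` of the fast oscillation of the state. -/
noncomputable def oscAmplitude (ε : ℝ) : ℝ := √(ε / (2 * π))

theorem oscAmplitude_pos {ε : ℝ} (hε : 0 < ε) : 0 < oscAmplitude ε :=
  sqrt_pos.2 (by positivity)

theorem oscAmplitude_sq {ε : ℝ} (hε : 0 ≤ ε) : oscAmplitude ε ^ 2 = ε / (2 * π) :=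
  sq_sqrt (by positivity)

theorem sqrt_two_pi_div (ε : ℝ) : √(2 * π / ε) = (oscAmplitude ε)⁻¹ := by
  rw [oscAmplitude, ← sqrt_inv, inv_div]

theorem two_pi_div {ε : ℝ} (hε : 0 ≤ ε) : 2 * π / ε = (oscAmplitude ε ^ 2)⁻¹ := by
  rw [oscAmplitude_sq hε, inv_div]

namespace ESData

variable {n : ℕ} {d : ESData n} {P : ℝ → RMat n} {pBarBar σ₀ ε : ℝ}

theorem PlantBounds.ABar_nonneg (h : d.PlantBounds) : 0 ≤ d.ABar :=
  (norm_nonneg _).trans (h.norm_A_le 0 le_rfl)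

theorem PlantBounds.DBBar_nonneg (h : d.PlantBounds) : 0 ≤ d.DBBar :=
  (norm_nonneg _).trans (h.norm_dot_B_le 0 le_rfl)

theorem PlantBounds.norm_DK_le (h : d.PlantBounds) {t : ℝ} (ht : 0 ≤ t) :
    ‖d.DK t‖ ≤ d.BBar ^ 2 * ‖d.K‖ :=
  (norm_outer_mul_le _ _).trans (by have := h.norm_B_le t ht; gcongr)

theorem PlantBounds.norm_DK_le_normDK (h : d.PlantBounds) {t : ℝ} (ht : 0 ≤ t) :
    ‖d.DK t‖ ≤ d.normDK := le_supNorm (fun _ => h.norm_DK_le) ht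

theorem PlantBounds.norm_H_le (h : d.PlantBounds) {t : ℝ} (ht : 0 ≤ t) :
    ‖d.H t‖ ≤ d.ABar + d.BBar ^ 2 * ‖d.K‖ :=
  (norm_sub_le _ _).trans (add_le_add (h.norm_A_le t ht) (h.norm_DK_le ht))

theorem norm_mul_le_of_forall_nonneg {M N : ℝ → RMat n} {a b : ℝ} (hM : ∀ t, 0 ≤ t → ‖M t‖ ≤ a)
    (hN : ∀ t, 0 ≤ t → ‖N t‖ ≤ b) (t : ℝ) (ht : 0 ≤ t) : ‖M t * N t‖ ≤ a * b :=
  norm_mul_le_of_le (hM t ht) (hN t ht)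

theorem norm_act_le_of_forall_nonneg {M : ℝ → RMat n} {v : ℝ → RVec n} {a b : ℝ}
    (hM : ∀ t, 0 ≤ t → ‖M t‖ ≤ a) (hv : ∀ t, 0 ≤ t → ‖v t‖ ≤ b) (t : ℝ) (ht : 0 ≤ t) :
    ‖act (M t) (v t)‖ ≤ a * b :=
  (norm_act_le _ _).trans (mul_le_mul (hM t ht) (hv t ht) (norm_nonneg _)
    ((norm_nonneg _).trans (hM t ht)))

theorem PlantBounds.norm_KB_le_normKB (h : d.PlantBounds) {t : ℝ} (ht : 0 ≤ t) :
    ‖act d.K (d.B t)‖ ≤ d.normKB :=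
  le_supNorm (f := fun t => act d.K (d.B t))
    (norm_act_le_of_forall_nonneg (M := fun _ => d.K) (fun _ _ => le_rfl) h.norm_B_le) ht

theorem normKB_nonneg (d : ESData n) : 0 ≤ d.normKB := supNorm_nonneg _

theorem normDK_nonneg (d : ESData n) : 0 ≤ d.normDK := supNorm_nonneg _

theorem rA_nonneg (d : ESData n) : 0 ≤ d.rA := Real.iSup_nonneg fun _ => ENNReal.toReal_nonneg

theorem isHermitian_symmetrized (hK : d.K.IsHermitian) (t : ℝ) :
    (d.K * d.A t + (d.A t).transpose * d.K).IsHermitian := by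
  rw [Matrix.IsHermitian, Matrix.conjTranspose_add, Matrix.conjTranspose_mul,
    Matrix.conjTranspose_mul, hK.eq, Matrix.conjTranspose_eq_transpose_of_trivial,
    Matrix.conjTranspose_eq_transpose_of_trivial, Matrix.transpose_transpose, add_comm]

theorem PlantBounds.abs_inner_A_K_le (h : d.PlantBounds) (hK : d.K.IsHermitian) {t : ℝ}
    (ht : 0 ≤ t) (v : RVec n) :
    |2 * (inner ℝ (act (d.A t) v) (act d.K v) : ℝ)| ≤ d.rA * ‖v‖ ^ 2 := by
  have hsym := isHermitian_symmetrized hK t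
  have e1 : 2 * (inner ℝ (act (d.A t) v) (act d.K v) : ℝ) =
      inner ℝ v (act (d.K * d.A t + (d.A t).transpose * d.K) v) := by
    rw [act_add, inner_add_right, act_mul, act_mul, inner_act_transpose,
      inner_act_comm_of_isHermitian hK, real_inner_comm]
    ring
  rw [e1]
  refine (abs_inner_act_le_spectralRadius hsym v).trans ?_
  gcongr
  obtain ⟨C, hC⟩ := exists_spectralRadius_le n
  refine le_ciSup (f := fun t : Set.Ici (0 : ℝ) => (spectralRadius ℂ
    ((d.K * d.A t + (d.A t).transpose * d.K).map (algebraMap ℝ ℂ))).toReal) ?_ ⟨t, ht⟩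
  refine ⟨|C| * (‖d.K‖ * d.ABar + d.ABar * ‖d.K‖), ?_⟩
  rintro _ ⟨s, rfl⟩
  refine (hC _ (isHermitian_symmetrized hK s)).trans ?_
  have hA := h.norm_A_le s s.2
  have h1 : ‖d.K * d.A s + (d.A s).transpose * d.K‖ ≤ ‖d.K‖ * d.ABar + d.ABar * ‖d.K‖ :=
    (norm_add_le _ _).trans (add_le_add (norm_mul_le_of_le le_rfl hA)
      (norm_mul_le_of_le ((norm_transpose_eq _).trans_le hA) le_rfl))
  exact mul_le_mul (le_abs_self C) h1 (norm_nonneg _) (abs_nonneg _)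

theorem c₁_eq (hδ : d.deltaBar = 0) (hε : 0 < ε) :
    d.c₁ ε = 2 * d.pBar * ((1 + oscAmplitude ε ^ 2 / 2 * d.normDK) * (oscAmplitude ε *
      (supNorm (fun t => act (d.H t) (d.B t)) + supNorm (fun t => act (d.DK t) (d.B t)) + d.DBBar
        + d.BBar * (2 * d.ABar * ‖d.K‖) * (2 * d.BBar ^ 2 * oscAmplitude ε ^ 2)))) := by
  have he0 := oscAmplitude_pos hε
  have h1 : √ε = √(2 * π) * oscAmplitude ε := by
    rw [oscAmplitude, ← sqrt_mul (by positivity)]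
    congr 1
    field_simp
  have h2 : √(2 * π) * √(2 / π ^ 3) = 2 / π := by
    rw [← sqrt_mul (by positivity), sqrt_eq_iff_mul_self_eq (by positivity) (by positivity)]
    field_simp
  rw [c₁, MC, hδ, h1]
  generalize supNorm (fun t => act (d.H t) (d.B t)) = x
  generalize supNorm (fun t => act (d.DK t) (d.B t)) = y
  have hs : √(2 * π) ≠ 0 := (sqrt_pos.2 (by positivity)).ne'
  have h3 : √(2 * π) * (1 / √(2 * π) * (x + y + d.DBBar)
      + √(2 / π ^ 3) * d.ABar * ‖d.K‖ * d.BBar ^ 3 * ε) =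
      (x + y + d.DBBar) + 2 / π * d.ABar * ‖d.K‖ * d.BBar ^ 3 * ε := by
    rw [← h2]; field_simp
  have h4 : ε / (4 * π) = oscAmplitude ε ^ 2 / 2 := by
    rw [oscAmplitude_sq hε.le]; field_simp; norm_num
  have h5 : 2 / π * d.ABar * ‖d.K‖ * d.BBar ^ 3 * ε =
      4 * oscAmplitude ε ^ 2 * d.ABar * ‖d.K‖ * d.BBar ^ 3 := by
    rw [oscAmplitude_sq hε.le]; field_simp; ring
  rw [h4]
  calc _ = 2 * d.pBar * oscAmplitude ε * (1 + oscAmplitude ε ^ 2 / 2 * d.normDK) *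
      (√(2 * π) * (1 / √(2 * π) * (x + y + d.DBBar)
      + √(2 / π ^ 3) * d.ABar * ‖d.K‖ * d.BBar ^ 3 * ε)) := by ring
    _ = _ := by rw [h3, h5]; ring

theorem c₂_eq (hδ : d.deltaBar = 0) (hε : 0 < ε) :
    d.c₂ ε = 2 * d.pBar * d.lam ε * (2 * oscAmplitude ε ^ 4 * d.rA * d.BBar ^ 2 * d.normDK
      + 2 * oscAmplitude ε ^ 2 * d.normKB * d.BBar * d.normDK
      + oscAmplitude ε ^ 2 / 2 * (2 * d.BBar * d.DBBar * ‖d.K‖ +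
        (supNorm (fun t => d.DK t * d.H t) + supNorm (fun t => d.H t * d.DK t)
            + supNorm (fun t => d.DK t * d.DK t)))) := by
  have h4 : oscAmplitude ε ^ 4 = (ε / (2 * π)) ^ 2 := by
    rw [← oscAmplitude_sq hε.le]; ring
  rw [c₂, hδ, h4, oscAmplitude_sq hε.le]
  field_simp
  ring

theorem c₃_eq (hε : 0 < ε) :
    d.c₃ ε = 2 * d.pBar * d.lam ε ^ 2 * (2 * oscAmplitude ε * d.normKB * d.normDK
      + (1 + oscAmplitude ε ^ 2 / 2 * d.normDK) * oscAmplitude ε * d.BBar *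
        (2 * d.ABar * ‖d.K‖) * 2) := by
  have he := oscAmplitude_pos hε
  have h1 : √(2 * ε / π) = 2 * oscAmplitude ε := by
    rw [sqrt_eq_iff_mul_self_eq (by positivity) (by positivity)]
    rw [show 2 * oscAmplitude ε * (2 * oscAmplitude ε) = 4 * oscAmplitude ε ^ 2 by ring,
      oscAmplitude_sq hε.le]
    field_simp
    norm_num
  have h4 : ε / (4 * π) = oscAmplitude ε ^ 2 / 2 := by
    rw [oscAmplitude_sq hε.le]; field_simp; norm_num
  rw [c₃, h1, h4]
  ring

theorem c₄_eq (hε : 0 < ε) :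
    d.c₄ ε = 2 * d.pBar * d.lam ε ^ 3 * (2 * oscAmplitude ε ^ 2 * d.rA * d.normDK) := by
  rw [c₄, oscAmplitude_sq hε.le]
  field_simp

theorem lam_eq (hε : 0 < ε) :
    d.lam ε = (1 - oscAmplitude ε ^ 2 / 2 * d.normDK)⁻¹ := by
  rw [lam, oscAmplitude_sq hε.le, ← inv_div]
  congr 1
  field_simp
  ring

theorem SmallParameter.half_le (hs : d.SmallParameter σ₀ ε) (hε : 0 < ε) :
    1 / 2 ≤ 1 - oscAmplitude ε ^ 2 / 2 * d.normDK := by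
  have := hs.first
  rw [oscAmplitude_sq hε.le]
  have h2 : ε / (2 * π) / 2 * d.normDK = ε * d.normDK / (4 * π) := by field_simp; ring
  rw [h2]
  have h3 : ε * d.normDK / (4 * π) ≤ 1 / 2 := by
    rw [div_le_div_iff₀ (by positivity) (by norm_num)]
    linarith
  linarith

theorem SmallParameter.lam_pos (hs : d.SmallParameter σ₀ ε) (hε : 0 < ε) : 0 < d.lam ε := by
  rw [lam_eq hε]
  have := hs.half_le hε
  positivity

theorem SmallParameter.lam_le_two (hs : d.SmallParameter σ₀ ε) (hε : 0 < ε) : d.lam ε ≤ 2 := by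
  rw [lam_eq hε]
  have := hs.half_le hε
  exact (inv_anti₀ (by norm_num) this).trans (by norm_num)

theorem c₁_nonneg (hδ : d.deltaBar = 0) (hp : d.PlantBounds) (hpb : 0 ≤ d.pBar) (hε : 0 < ε) :
    0 ≤ d.c₁ ε := by
  have := oscAmplitude_pos hε
  have := hp.ABar_nonneg
  have := hp.DBBar_nonneg
  have := hp.BBar_pos
  have := d.normDK_nonneg
  have := supNorm_nonneg (fun t => act (d.H t) (d.B t))
  have := supNorm_nonneg (fun t => act (d.DK t) (d.B t))
  rw [c₁_eq hδ hε]
  positivity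

theorem SmallParameter.c₃_nonneg (hs : d.SmallParameter σ₀ ε) (hp : d.PlantBounds)
    (hpb : 0 ≤ d.pBar) (hε : 0 < ε) : 0 ≤ d.c₃ ε := by
  have := oscAmplitude_pos hε
  have := hp.ABar_nonneg
  have := hp.BBar_pos
  have := d.normDK_nonneg
  have := d.normKB_nonneg
  have := hs.lam_pos hε
  rw [c₃_eq hε]
  positivity

theorem SmallParameter.c₄_nonneg (hs : d.SmallParameter σ₀ ε)
    (hpb : 0 ≤ d.pBar) (hε : 0 < ε) : 0 ≤ d.c₄ ε := by
  have := d.normDK_nonneg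
  have := d.rA_nonneg
  have := hs.lam_pos hε
  rw [c₄_eq hε]
  positivity

theorem initBound_nonneg (d : ESData n) (hpb : 0 ≤ d.pBar) (σ₀ : ℝ) (hε : 0 < ε) :
    0 ≤ d.initBound σ₀ ε := by
  have := d.normDK_nonneg
  unfold initBound
  positivity

/-- The denominator of the larger root `ξ_l` does not vanish: otherwise `ξ_l` would be the junk value
`0`, which does not exceed `initBound ≥ 0`. -/
theorem SmallParameter.c₃_add_pos (hs : d.SmallParameter σ₀ ε) (hp : d.PlantBounds)
    (hpb : 0 ≤ d.pBar) (hε : 0 < ε) : 0 < d.c₃ ε + 2 * d.c₄ ε := by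
  have h3 := hs.c₃_nonneg hp hpb hε
  have h4 := hs.c₄_nonneg hpb hε
  rcases (by positivity : 0 ≤ d.c₃ ε + 2 * d.c₄ ε).eq_or_lt with h | h
  · have h5 := hs.fourth
    have h6 := d.initBound_nonneg hpb σ₀ hε
    have h7 : d.xiL ε = 0 := by
      rw [xiL, (by linarith : 2 * d.c₃ ε + 4 * d.c₄ ε = 0), div_zero]
    linarith
  · exact h

theorem SmallParameter.radicand_pos (hs : d.SmallParameter σ₀ ε) (hl : 0 < d.pLow) :
    0 < d.q ^ 2 * d.pLow ^ 4 - 4 * d.c₁ ε * (d.c₃ ε + 2 * d.c₄ ε) * d.pLow ^ 2 := by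
  have := mul_pos (sub_pos.2 hs.third) (pow_pos hl 2)
  linarith

theorem SmallParameter.disc_pos (hs : d.SmallParameter σ₀ ε) (hl : 0 < d.pLow) :
    0 < d.disc ε := sqrt_pos.2 (hs.radicand_pos hl)

theorem SmallParameter.disc_sq (hs : d.SmallParameter σ₀ ε) (hl : 0 < d.pLow) :
    d.disc ε ^ 2 = d.q ^ 2 * d.pLow ^ 4 - 4 * d.c₁ ε * (d.c₃ ε + 2 * d.c₄ ε) * d.pLow ^ 2 :=
  sq_sqrt (hs.radicand_pos hl).le

theorem SmallParameter.xiS_lt_xiL (hs : d.SmallParameter σ₀ ε) (hp : d.PlantBounds)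
    (hl : d.LyapunovBounds P pBarBar) (hε : 0 < ε) : d.xiS ε < d.xiL ε := by
  have h1 := hs.c₃_add_pos hp hl.pBar_pos.le hε
  have hS := hs.disc_pos hl.pLow_pos
  have hq := hl.q_pos
  have hpl := hl.pLow_pos
  have hS2 := hs.disc_sq hl.pLow_pos
  have hd : 0 < d.q * d.pLow ^ 2 + d.disc ε := by positivity
  rw [xiS, xiL, div_lt_div_iff₀ hd (by linarith)]
  have := mul_pos hS hd
  linarith

theorem xiS_le (hδ : d.deltaBar = 0) (hp : d.PlantBounds) (hl : d.LyapunovBounds P pBarBar)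
    (hε : 0 < ε) : d.xiS ε ≤ 2 * d.c₁ ε / d.q := by
  have := c₁_nonneg hδ hp hl.pBar_pos.le hε
  have hS : 0 ≤ d.disc ε := sqrt_nonneg _
  have hq := hl.q_pos
  have hpl := hl.pLow_pos
  calc d.xiS ε ≤ 2 * d.c₁ ε * d.pLow ^ 2 / (d.q * d.pLow ^ 2) := by
        unfold xiS; gcongr; linarith
    _ = _ := by field_simp

end ESData

end Design

/-! ### The transient bound for the undelayed system -/

section ReducedSystem

open Real

/-- A matrix as a continuous operator on the Euclidean space. -/
noncomputable abbrev toOp {n : ℕ} (M : RMat n) : RVec n →L[ℝ] RVec n :=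
  Matrix.toEuclideanCLM (n := Fin n) (𝕜 := ℝ) M

theorem hasDerivWithinAt_toOp {n : ℕ} {M : ℝ → RMat n} {M' : RMat n} {s : Set ℝ} {t : ℝ}
    (h : HasDerivWithinAt M M' s t) : HasDerivWithinAt (fun r => toOp (M r)) (toOp M') s t :=
  ((Matrix.toEuclideanCLM (n := Fin n) (𝕜 := ℝ)).toAlgEquiv.toLinearMap.toContinuousLinearMap
    ).hasFDerivAt.comp_hasDerivWithinAt t h

namespace ESData

variable {n : ℕ} {d : ESData n} {P : ℝ → RMat n} {pBarBar σ₀ ε : ℝ} {ζ : ℝ → RVec n}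

/-- `ζ` solves the undelayed closed loop system `ζ̇ = A ζ + B u` on `[0, ∞)`. -/
def IsReducedSolution (d : ESData n) (ε : ℝ) (ζ : ℝ → RVec n) : Prop :=
  ∀ t, 0 ≤ t → HasDerivWithinAt ζ (act (d.A t) (ζ t) +
    ((oscAmplitude ε)⁻¹ * cos (oscPhase (toOp d.K) (oscAmplitude ε) ζ t)) • d.B t) (Set.Ici 0) t

theorem PlantBounds.norm_demodulated_sub_le (hp : d.PlantBounds) (hε : 0 < ε) {t : ℝ}
    (ht : 0 ≤ t) :
    ‖ζ t - demodulated (toOp d.K) (oscAmplitude ε) d.B ζ t‖ ≤ d.BBar * oscAmplitude ε := by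
  have he := oscAmplitude_pos hε
  rw [demodulated, sub_sub_cancel, norm_smul, Real.norm_eq_abs, abs_mul, abs_of_pos he]
  calc oscAmplitude ε * |sin _| * ‖d.B t‖ ≤ oscAmplitude ε * 1 * d.BBar := by
        gcongr
        · exact abs_sin_le_one _
        · exact hp.norm_B_le t ht
    _ = _ := by ring

theorem PlantBounds.norm_averagedState_sub_le (hp : d.PlantBounds) {t : ℝ}
    (ht : 0 ≤ t) {e : ℝ} :
    ‖averagedState (toOp d.K) e d.B ζ t - demodulated (toOp d.K) e d.B ζ t‖ ≤
      e ^ 2 / 2 * d.normDK * ‖demodulated (toOp d.K) e d.B ζ t‖ := by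
  set z := demodulated (toOp d.K) e d.B ζ t with hz
  have h1 : averagedState (toOp d.K) e d.B ζ t - z =
      (e ^ 2 / 2 * sin (2 * oscPhase (toOp d.K) e ζ t)) • act (d.DK t) z := by
    rw [DK, act_outer_mul, smul_smul, averagedState, ← hz, add_sub_cancel_left]
  have h2 : ‖act (d.DK t) z‖ ≤ d.normDK * ‖z‖ :=
    (norm_act_le _ _).trans (by gcongr; exact hp.norm_DK_le_normDK ht)
  rw [h1, norm_smul, Real.norm_eq_abs, abs_mul, abs_of_nonneg (by positivity : 0 ≤ e ^ 2 / 2)]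
  calc e ^ 2 / 2 * |sin (2 * oscPhase (toOp d.K) e ζ t)| * ‖act (d.DK t) z‖
      ≤ e ^ 2 / 2 * 1 * (d.normDK * ‖z‖) := by
        gcongr
        exact abs_sin_le_one _
    _ = _ := by ring

/-- The averaging change of variables is invertible, with the constant `λ`. -/
theorem SmallParameter.norm_demodulated_le (hs : d.SmallParameter σ₀ ε) (hp : d.PlantBounds)
    (hε : 0 < ε) {t : ℝ} (ht : 0 ≤ t) :
    ‖demodulated (toOp d.K) (oscAmplitude ε) d.B ζ t‖ ≤
      d.lam ε * ‖averagedState (toOp d.K) (oscAmplitude ε) d.B ζ t‖ := by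
  have h1 := hp.norm_averagedState_sub_le ht (ζ := ζ) (e := oscAmplitude ε)
  have h2 := norm_sub_norm_le (demodulated (toOp d.K) (oscAmplitude ε) d.B ζ t)
    (averagedState (toOp d.K) (oscAmplitude ε) d.B ζ t)
  rw [norm_sub_rev] at h1
  have h3 := hs.half_le hε
  rw [lam_eq hε, inv_mul_eq_div, le_div_iff₀ (by linarith)]
  linarith

theorem LyapunovBounds.decay_inner (hl : d.LyapunovBounds P pBarBar) {t : ℝ} (ht : 0 ≤ t)
    (v : RVec n) :
    (inner ℝ v (act (dot P t) v) : ℝ) + 2 * inner ℝ (act (P t) v) (act (d.H t) v) ≤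
      -d.q * inner ℝ v (act (P t) v) := by
  have h := inner_act_nonneg (hl.decay t ht) v
  have hsym := inner_act_comm_of_isHermitian (hl.posDef_P t ht).isHermitian
  have h1 : act (-(d.q • P t) - (dot P t + P t * d.H t + (d.H t).transpose * P t)) v =
      -(d.q • act (P t) v) - (act (dot P t) v + act (P t) (act (d.H t) v)
        + act (d.H t).transpose (act (P t) v)) := by
    rw [act_sub, act_add, act_add, act_mul, act_mul]
    simp [act]
  rw [h1, inner_sub_right, inner_neg_right, inner_smul_right, inner_add_right, inner_add_right,
    inner_act_transpose] at h
  have h2 := hsym v (act (d.H t) v)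
  have h3 := real_inner_comm (act (P t) v) (act (d.H t) v)
  linarith

theorem LyapunovBounds.le_inner (hl : d.LyapunovBounds P pBarBar) {t : ℝ} (ht : 0 ≤ t)
    (v : RVec n) : d.pLow * ‖v‖ ^ 2 ≤ inner ℝ v (act (P t) v) := by
  have h := inner_act_nonneg (hl.low_le_P t ht) v
  rw [act_sub, inner_sub_right] at h
  simp only [act, map_smul, map_one, smul_apply,
    one_apply_eq_self, inner_smul_right, real_inner_self_eq_norm_sq] at h
  linarith

theorem LyapunovBounds.inner_le (hl : d.LyapunovBounds P pBarBar) {t : ℝ} (ht : 0 ≤ t)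
    (v : RVec n) : inner ℝ v (act (P t) v) ≤ d.pBar * ‖v‖ ^ 2 := by
  refine (real_inner_le_norm _ _).trans ?_
  calc ‖v‖ * ‖act (P t) v‖ ≤ ‖v‖ * (d.pBar * ‖v‖) := by
        gcongr
        exact (norm_act_le _ _).trans (by gcongr; exact hl.norm_P_le t ht)
    _ = _ := by ring

/-- The quadratic Lyapunov function evaluated along the averaged state. -/
noncomputable def averagedEnergy (d : ESData n) (P : ℝ → RMat n) (ε : ℝ) (ζ : ℝ → RVec n)
    (t : ℝ) : ℝ :=
  inner ℝ (averagedState (toOp d.K) (oscAmplitude ε) d.B ζ t)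
    (toOp (P t) (averagedState (toOp d.K) (oscAmplitude ε) d.B ζ t))

/-- The averaging remainder in terms of the constants `c₁, …, c₄` of the design. -/
theorem norm_averagingRemainder_le (hδ : d.deltaBar = 0) (hp : d.PlantBounds)
    (hK : d.K.IsHermitian) (hpb : 0 ≤ d.pBar) (hε : 0 < ε) {t : ℝ} (ht : 0 ≤ t) {θ ν e Y : ℝ}
    {z w ζ : RVec n} (hedef : e = oscAmplitude ε) (hζ : ζ = z + (e * sin θ) • d.B t)
    (hw : w = demodError (toOp (d.A t)) (toOp (d.DK t)) (toOp d.K) θ (d.B t) (dot d.B t) ζ)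
    (hν : ν = 2 * inner ℝ (toOp (d.A t) ζ) (toOp d.K ζ) +
      2 * e⁻¹ * cos θ * inner ℝ (d.B t) (toOp d.K ζ)) (hY : 0 ≤ Y) (hZY : ‖z‖ ≤ d.lam ε * Y) :
    2 * d.pBar * Y * ‖averagingRemainder (toOp (d.A t)) (toOp (d.DK t)) (toOp d.K) e θ ν (d.B t)
        (dot d.B t) z w‖ ≤
      d.c₁ ε * Y + d.c₂ ε * Y ^ 2 + d.c₃ ε * Y ^ 3 + d.c₄ ε * Y ^ 4 := by
  have he : 0 < e := hedef ▸ oscAmplitude_pos hε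
  have hH : ∀ v, toOp (d.H t) v = toOp (d.A t) v - toOp (d.DK t) v := fun v => act_sub _ _ _
  have hHb := norm_act_le_of_forall_nonneg (fun t ht => hp.norm_H_le ht) hp.norm_B_le
  have hDb := norm_act_le_of_forall_nonneg (fun t ht => hp.norm_DK_le ht) hp.norm_B_le
  have hrem := norm_averaging_remainder_le (A := toOp (d.A t)) (K := toOp d.K)
    (D := toOp (d.DK t)) he (θ := θ) (z := z) (b := d.B t)
    (b' := dot d.B t) (ζ := ζ) (α := 2 * d.ABar * ‖d.K‖) (ρ := d.rA) (β := d.BBar)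
    (δ := d.DBBar) (mH := supNorm fun t => act (d.H t) (d.B t))
    (mD := supNorm fun t => act (d.DK t) (d.B t)) (dk := d.normDK) (kb := d.normKB) (k := ‖d.K‖)
    (m₁ := supNorm fun t => d.DK t * d.H t) (m₂ := supNorm fun t => d.H t * d.DK t)
    (m₃ := supNorm fun t => d.DK t * d.DK t) hζ hw hν
    ?_ ?_ (hp.abs_inner_A_K_le hK ht _) d.rA_nonneg (hp.norm_B_le t ht)
    (hp.norm_dot_B_le t ht) ?_ (le_supNorm (f := fun t => act (d.DK t) (d.B t)) hDb ht)
    (fun v => (norm_act_le _ _).trans (by gcongr; exact hp.norm_DK_le_normDK ht))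
    d.normDK_nonneg ?_ d.normKB_nonneg (norm_act_le _) ?_ ?_ ?_
  rotate_left
  · rw [abs_mul, abs_two]
    calc 2 * |(inner ℝ (toOp (d.A t) ζ) (toOp d.K ζ) : ℝ)|
        ≤ 2 * ((d.ABar * ‖ζ‖) * (‖d.K‖ * ‖ζ‖)) := by
          gcongr
          refine (abs_real_inner_le_norm _ _).trans ?_
          have h1 : ‖act (d.A t) ζ‖ ≤ d.ABar * ‖ζ‖ :=
            (norm_act_le _ _).trans (by gcongr; exact hp.norm_A_le t ht)
          have h2 := norm_act_le d.K ζ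
          have := hp.ABar_nonneg
          gcongr
      _ = _ := by ring
  · have := hp.ABar_nonneg
    positivity
  · rw [← hH]
    exact le_supNorm (f := fun t => act (d.H t) (d.B t)) hHb ht
  · rw [inner_act_comm_of_isHermitian hK]
    exact (abs_real_inner_le_norm _ _).trans (by gcongr; exact hp.norm_KB_le_normKB ht)
  · rw [← hH]
    change ‖act (d.DK t) (act (d.H t) z)‖ ≤ _
    rw [← act_mul]
    refine (norm_act_le _ _).trans ?_
    gcongr
    exact le_supNorm (f := fun t => d.DK t * d.H t)
      (norm_mul_le_of_forall_nonneg (fun t ht => hp.norm_DK_le ht) (fun t ht => hp.norm_H_le ht)) ht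
  · rw [← hH]
    change ‖act (d.H t) (act (d.DK t) z)‖ ≤ _
    rw [← act_mul]
    refine (norm_act_le _ _).trans ?_
    gcongr
    exact le_supNorm (f := fun t => d.H t * d.DK t)
      (norm_mul_le_of_forall_nonneg (fun t ht => hp.norm_H_le ht) (fun t ht => hp.norm_DK_le ht)) ht
  · change ‖act (d.DK t) (act (d.DK t) z)‖ ≤ _
    rw [← act_mul]
    refine (norm_act_le _ _).trans ?_
    gcongr
    exact le_supNorm (f := fun t => d.DK t * d.DK t)
      (norm_mul_le_of_forall_nonneg (fun t ht => hp.norm_DK_le ht) (fun t ht => hp.norm_DK_le ht)) ht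
  have hq := averaging_remainder_le_quartic (p := d.pBar) (e := e) (dk := d.normDK)
    (kb := d.normKB) (w₀ := supNorm (fun t => act (d.H t) (d.B t)) +
      supNorm (fun t => act (d.DK t) (d.B t)) + d.DBBar) (σ := 1 + e ^ 2 / 2 * d.normDK)
    (α := 2 * d.ABar * ‖d.K‖) (ρ := d.rA) (β := d.BBar)
    (m := 2 * d.BBar * d.DBBar * ‖d.K‖ + (supNorm (fun t => d.DK t * d.H t) +
      supNorm (fun t => d.H t * d.DK t) + supNorm (fun t => d.DK t * d.DK t)))
    (lam := d.lam ε) (Z := ‖z‖) (Y := Y) hpb he.le d.normDK_nonneg d.normKB_nonneg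
    (by have := hp.ABar_nonneg; positivity) d.rA_nonneg hp.BBar_pos.le
    (add_nonneg (mul_nonneg (mul_nonneg (mul_nonneg two_pos.le hp.BBar_pos.le) hp.DBBar_nonneg)
      (norm_nonneg _)) (add_nonneg (add_nonneg (supNorm_nonneg _) (supNorm_nonneg _))
      (supNorm_nonneg _)))
    (by have := d.normDK_nonneg; positivity) hY (norm_nonneg _)
    hZY
  subst hedef
  rw [← c₁_eq hδ hε, ← c₂_eq hδ hε, ← c₃_eq hε, ← c₄_eq hε] at hq
  exact (mul_le_mul_of_nonneg_left hrem
    (by positivity)).trans hq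

/-- Along a solution of the reduced system the averaged state follows `ẏ = H y` up to a remainder
that is controlled by the constants `c₁, …, c₄` of the design. -/
theorem exists_hasDerivWithinAt_averagedState (hδ : d.deltaBar = 0) (hp : d.PlantBounds)
    (hl : d.LyapunovBounds P pBarBar) (hε : 0 < ε) (hs : d.SmallParameter σ₀ ε)
    (hζ : d.IsReducedSolution ε ζ) {t : ℝ} (ht : 0 ≤ t) {y : RVec n}
    (hy₀ : y = averagedState (toOp d.K) (oscAmplitude ε) d.B ζ t) :
    ∃ R, HasDerivWithinAt (averagedState (toOp d.K) (oscAmplitude ε) d.B ζ)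
        (toOp (d.H t) y + R) (Set.Ici 0) t ∧
      2 * d.pBar * ‖y‖ * ‖R‖ ≤
        d.c₁ ε * ‖y‖ + d.c₂ ε * ‖y‖ ^ 2 + d.c₃ ε * ‖y‖ ^ 3 + d.c₄ ε * ‖y‖ ^ 4 := by
  have he := oscAmplitude_pos hε
  set e := oscAmplitude ε with hedef
  have hK : ∀ u v : RVec n, (inner ℝ u (toOp d.K v) : ℝ) = inner ℝ (toOp d.K u) v :=
    inner_act_comm_of_isHermitian hl.posDef_K.isHermitian
  have hD : ∀ v, toOp (d.DK t) v = (inner ℝ (d.B t) (toOp d.K v) : ℝ) • d.B t :=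
    fun v => act_outer_mul _ _ _
  have hb : HasDerivWithinAt d.B (dot d.B t) (Set.Ici 0) t :=
    (hp.differentiableOn_B t ht).hasDerivWithinAt
  have hH : ∀ v, toOp (d.H t) v = toOp (d.A t) v - toOp (d.DK t) v := fun v => act_sub _ _ _
  have hyd := hasDerivWithinAt_averagedState (A := toOp (d.A t)) (D := toOp (d.DK t)) he.ne' hK hD
    hb (hζ t ht) rfl rfl rfl rfl
  rw [← hH, ← hy₀] at hyd
  exact ⟨_, hyd, norm_averagingRemainder_le hδ hp hl.posDef_K.isHermitian hl.pBar_pos.le hε ht rfl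
    (by simp [demodulated]) rfl rfl (norm_nonneg _) (hy₀ ▸ hs.norm_demodulated_le hp hε ht)⟩

/-- Along a solution of the reduced system the averaged energy satisfies the logistic differential
inequality with equilibria `ξ_s` and `ξ_l`. -/
theorem exists_hasDerivWithinAt_averagedEnergy_le (hδ : d.deltaBar = 0) (hp : d.PlantBounds)
    (hl : d.LyapunovBounds P pBarBar) (hε : 0 < ε) (hs : d.SmallParameter σ₀ ε)
    (hζ : d.IsReducedSolution ε ζ) {t : ℝ} (ht : 0 ≤ t) :
    ∃ W', HasDerivWithinAt (d.averagedEnergy P ε ζ) W' (Set.Ici 0) t ∧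
      W' ≤ (d.c₃ ε / 2 + d.c₄ ε) / d.pLow ^ 2 * (d.averagedEnergy P ε ζ t - d.xiS ε) *
        (d.averagedEnergy P ε ζ t - d.xiL ε) := by
  have hP : HasDerivWithinAt P (dot P t) (Set.Ici 0) t :=
    ((hl.contDiffOn_P.differentiableOn one_ne_zero) t ht).hasDerivWithinAt
  obtain ⟨R, hy, hR⟩ := exists_hasDerivWithinAt_averagedState hδ hp hl hε hs hζ ht rfl
  obtain ⟨W', hW', hle⟩ := exists_hasDerivWithinAt_quadratic_le (p := d.pBar) (hasDerivWithinAt_toOp hP)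
    (inner_act_comm_of_isHermitian (hl.posDef_P t ht).isHermitian) (hl.decay_inner ht)
    (fun v => (norm_act_le (P t) v).trans (by gcongr; exact hl.norm_P_le t ht)) hy
  refine ⟨W', hW', hle.trans ?_⟩
  set y := averagedState (toOp d.K) (oscAmplitude ε) d.B ζ t with hydef
  have hfin := quartic_le_logistic (W := d.averagedEnergy P ε ζ t) (c₄ := d.c₄ ε) hl.pLow_pos
    (c₁_nonneg hδ hp hl.pBar_pos.le hε) (hs.c₃_nonneg hp hl.pBar_pos.le hε)
    (hs.c₃_add_pos hp hl.pBar_pos.le hε) (hl.le_inner ht y) hs.second hl.q_pos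
    (hs.disc_pos hl.pLow_pos).le (hs.disc_sq hl.pLow_pos)
  exact (add_le_add le_rfl hR).trans hfin

theorem averagedEnergy_zero_le (hp : d.PlantBounds)
    (hl : d.LyapunovBounds P pBarBar) (hε : 0 < ε) (h0 : ‖ζ 0‖ ≤ σ₀) :
    d.averagedEnergy P ε ζ 0 ≤ d.initBound σ₀ ε := by
  have he := oscAmplitude_pos hε
  have h4 : ε / (4 * π) = oscAmplitude ε ^ 2 / 2 := by
    rw [oscAmplitude_sq hε.le]; field_simp; norm_num
  have hdk := d.normDK_nonneg
  have hpb := hl.pBar_pos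
  have hB := hp.BBar_pos
  have hz := hp.norm_demodulated_sub_le (ζ := ζ) hε le_rfl
  have hy := hp.norm_averagedState_sub_le (ζ := ζ) (e := oscAmplitude ε) le_rfl
  refine (hl.inner_le le_rfl _).trans ?_
  rw [initBound, h4, ← oscAmplitude_sq hε.le]
  set y := averagedState (toOp d.K) (oscAmplitude ε) d.B ζ 0
  set z := demodulated (toOp d.K) (oscAmplitude ε) d.B ζ 0
  set e := oscAmplitude ε
  have hy' : ‖y‖ ≤ (1 + e ^ 2 / 2 * d.normDK) * ‖z‖ := by
    have := norm_sub_norm_le y z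
    linarith
  have hz' : ‖z‖ ≤ σ₀ + d.BBar * e := by
    rw [norm_sub_rev] at hz
    have := norm_sub_norm_le z (ζ 0)
    linarith
  have hz2 : ‖z‖ ^ 2 ≤ 2 * (σ₀ ^ 2 + d.BBar ^ 2 * e ^ 2) := by
    have := pow_le_pow_left₀ (norm_nonneg _) hz' 2
    nlinarith [sq_nonneg (σ₀ - d.BBar * e)]
  calc d.pBar * ‖y‖ ^ 2 ≤ d.pBar * ((1 + e ^ 2 / 2 * d.normDK) * ‖z‖) ^ 2 := by gcongr
    _ = d.pBar * (1 + e ^ 2 / 2 * d.normDK) ^ 2 * ‖z‖ ^ 2 := by ring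
    _ ≤ d.pBar * (1 + e ^ 2 / 2 * d.normDK) ^ 2 * (2 * (σ₀ ^ 2 + d.BBar ^ 2 * e ^ 2)) := by gcongr
    _ = _ := by ring

/-- The transient bound for the reduced system. -/
theorem IsReducedSolution.norm_le_stateBound (hδ : d.deltaBar = 0) (hp : d.PlantBounds)
    (hl : d.LyapunovBounds P pBarBar) (hε : 0 < ε) (hs : d.SmallParameter σ₀ ε)
    (hζ : d.IsReducedSolution ε ζ) (h0 : ‖ζ 0‖ ≤ σ₀) {ξ₀ : ℝ}
    (h₀ : max (d.xiS ε) (d.initBound σ₀ ε) < ξ₀) (h₁ : ξ₀ < d.xiL ε) {t : ℝ} (ht : 0 ≤ t) :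
    ‖ζ t‖ ≤ d.stateBound ε ξ₀ t := by
  have hder : ∀ t, ∃ W', 0 ≤ t → HasDerivWithinAt (d.averagedEnergy P ε ζ) W' (Set.Ici 0) t ∧
      W' ≤ (d.c₃ ε / 2 + d.c₄ ε) / d.pLow ^ 2 * (d.averagedEnergy P ε ζ t - d.xiS ε) *
        (d.averagedEnergy P ε ζ t - d.xiL ε) := fun t => by
    by_cases ht : 0 ≤ t
    · obtain ⟨W', h⟩ := exists_hasDerivWithinAt_averagedEnergy_le hδ hp hl hε hs hζ ht
      exact ⟨W', fun _ => h⟩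
    · exact ⟨0, fun h => absurd h ht⟩
  choose W' hW' using hder
  have hW := le_logisticCurve ((le_max_left _ _).trans_lt h₀) h₁
    ((averagedEnergy_zero_le hp hl hε h0).trans ((le_max_right _ _).trans h₀.le))
    (fun t ht => (hW' t ht).1) (fun t ht => (hW' t ht).2) ht
  have hr : (d.c₃ ε / 2 + d.c₄ ε) / d.pLow ^ 2 * (d.xiL ε - d.xiS ε) = d.r₀ ε := by
    rw [r₀]; ring
  rw [hr] at hW
  have hpl := hl.pLow_pos
  have hlam := hs.lam_pos hε
  have hz := hp.norm_demodulated_sub_le (ζ := ζ) hε ht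
  have hy := hs.norm_demodulated_le (ζ := ζ) hp hε ht
  have hlow := hl.le_inner ht (averagedState (toOp d.K) (oscAmplitude ε) d.B ζ t)
  have hyn : ‖averagedState (toOp d.K) (oscAmplitude ε) d.B ζ t‖ ≤
      √(logisticCurve (d.xiS ε) (d.xiL ε) ξ₀ (d.r₀ ε) t) / √d.pLow := by
    rw [← sqrt_div' _ hpl.le]
    refine le_sqrt_of_sq_le ?_
    rw [le_div_iff₀ hpl, mul_comm]
    exact hlow.trans hW
  have h3 := norm_sub_norm_le (ζ t) (demodulated (toOp d.K) (oscAmplitude ε) d.B ζ t)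
  have h4 := mul_le_mul_of_nonneg_left hyn hlam.le
  have h5 : d.stateBound ε ξ₀ t = d.lam ε *
      (√(logisticCurve (d.xiS ε) (d.xiL ε) ξ₀ (d.r₀ ε) t) / √d.pLow) +
        d.BBar * oscAmplitude ε := by
    rw [stateBound, logisticCurve, oscAmplitude]; ring
  rw [h5]
  linarith

end ESData

end ReducedSystem

/-! ### Transition matrices -/

section Transition

variable {n : ℕ} {E : ℝ → RMat n}

/-- The solution `Z` of the adjoint equation `Ż = -Z E` with `Z 0 = I`. -/
noncomputable def adjointTransition (E : ℝ → RMat n) (t : ℝ) : RMat n :=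
  (stateTransition (fun r => -(E r).transpose) t 0).transpose

theorem HasDerivAt.matrix_transpose {M : ℝ → RMat n} {M' : RMat n} {t : ℝ}
    (h : HasDerivAt M M' t) : HasDerivAt (fun r => (M r).transpose) M'.transpose t :=
  ((Matrix.transposeLinearEquiv (Fin n) (Fin n) ℝ ℝ).toLinearMap.toContinuousLinearMap
    ).hasFDerivAt.comp_hasDerivAt t h

theorem hasDerivAt_adjointTransition (hE : Continuous E) (t : ℝ) :
    HasDerivAt (adjointTransition E) (-(adjointTransition E t * E t)) t := by
  have hc : Continuous fun r => -(E r).transpose := by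
    have : Continuous fun r => (E r).transpose := hE.matrix_transpose
    exact this.neg
  have h := ((isStateTransition_stateTransition hc 0).2 t).matrix_transpose
  refine h.congr_deriv ?_
  rw [Matrix.transpose_mul, Matrix.transpose_neg, Matrix.transpose_transpose, mul_neg]
  rfl

theorem adjointTransition_zero (hE : Continuous E) : adjointTransition E 0 = 1 := by
  have hc : Continuous fun r => -(E r).transpose := by
    have : Continuous fun r => (E r).transpose := hE.matrix_transpose
    exact this.neg
  rw [adjointTransition, (isStateTransition_stateTransition hc 0).1, Matrix.transpose_one]

/-- The product `Z(t) Φ(t, s)` does not depend on `t`. -/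
theorem adjointTransition_mul_stateTransition (hE : Continuous E) (t s : ℝ) :
    adjointTransition E t * stateTransition E t s = adjointTransition E s := by
  have hd : ∀ r, HasDerivAt (fun r => adjointTransition E r * stateTransition E r s) 0 r := by
    intro r
    have h := (hasDerivAt_adjointTransition hE r).mul
      ((isStateTransition_stateTransition hE s).2 r)
    refine h.congr_deriv ?_
    noncomm_ring
  have h := is_const_of_deriv_eq_zero (fun r => (hd r).differentiableAt)
    (fun r => (hd r).deriv) t s
  simpa only [(isStateTransition_stateTransition hE s).1, mul_one] using h

theorem stateTransition_zero_mul_adjointTransition (hE : Continuous E) (t : ℝ) :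
    stateTransition E t 0 * adjointTransition E t = 1 := by
  rw [mul_eq_one_comm, adjointTransition_mul_stateTransition hE, adjointTransition_zero hE]

theorem stateTransition_eq_mul (hE : Continuous E) (t s : ℝ) :
    stateTransition E t s = stateTransition E t 0 * adjointTransition E s := by
  rw [← adjointTransition_mul_stateTransition hE t s, ← mul_assoc,
    stateTransition_zero_mul_adjointTransition hE, one_mul]

theorem norm_stateTransition_le (hE : Continuous E) {M : ℝ} (hM : ∀ r, ‖E r‖ ≤ M) (t s : ℝ) :
    ‖stateTransition E t s‖ ≤ ‖(1 : RMat n)‖ * Real.exp (M * |t - s|) := by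
  have hs : HasSum (fun k : ℕ => ‖(1 : RMat n)‖ * ((M * |t - s|) ^ k / k.factorial))
      (‖(1 : RMat n)‖ * Real.exp (M * |t - s|)) := by
    rw [Real.exp_eq_exp_ℝ]
    exact (NormedSpace.expSeries_div_hasSum_exp (M * |t - s|)).mul_left _
  refine tsum_of_norm_bounded hs fun k => ?_
  rw [← mul_div_assoc]
  exact norm_peanoBakerTerm_le hE s |t - s| M (fun r _ => hM r) k t le_rfl

end Transition

/-! ### The reduction term -/

section Delay

open Real MeasureTheory

variable {n : ℕ} {τ ε : ℝ} {A : ℝ → RMat n} {B : ℝ → RVec n} {K : RMat n} {ζ : ℝ → RVec n}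

theorem esControl_of_neg {t : ℝ} (ht : t < 0) : esControl ε K ζ t = 0 := if_pos ht

theorem esControl_of_nonneg (hε : 0 < ε) {t : ℝ} (ht : 0 ≤ t) :
    esControl ε K ζ t =
      (oscAmplitude ε)⁻¹ * cos (oscPhase (toOp K) (oscAmplitude ε) ζ t) := by
  rw [esControl, if_neg ht.not_gt, sqrt_two_pi_div, two_pi_div hε.le]
  rfl

theorem continuousOn_oscPhase (hζ : ContinuousOn ζ (Set.Ici 0)) (e : ℝ) :
    ContinuousOn (oscPhase (toOp K) e ζ) (Set.Ici 0) :=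
  (continuousOn_const.mul continuousOn_id).add
    (hζ.inner ((toOp K).continuous.comp_continuousOn hζ))

theorem continuousOn_esControl (hε : 0 < ε) (hζ : ContinuousOn ζ (Set.Ici 0)) :
    ContinuousOn (esControl ε K ζ) (Set.Ici 0) :=
  (continuousOn_const.mul (continuous_cos.comp_continuousOn (continuousOn_oscPhase hζ _))).congr
    fun _ ht => esControl_of_nonneg hε ht

/-- The integrand of the reduction term, pulled back to time `0` by the transition matrix. -/
noncomputable def pulledControl (τ ε : ℝ) (A : ℝ → RMat n) (B : ℝ → RVec n) (K : RMat n)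
    (ζ : ℝ → RVec n) (m : ℝ) : RVec n :=
  esControl ε K ζ m • act (adjointTransition (fun r => A (r + τ)) m) (B (m + τ))

/-- The primitive of the pulled back integrand over nonnegative times. -/
noncomputable def pulledPrimitive (τ ε : ℝ) (A : ℝ → RMat n) (B : ℝ → RVec n) (K : RMat n)
    (ζ : ℝ → RVec n) (t : ℝ) : RVec n :=
  ∫ m in (0 : ℝ)..t, pulledControl τ ε A B K ζ (max m 0)

theorem pulledControl_of_neg {m : ℝ} (hm : m < 0) : pulledControl τ ε A B K ζ m = 0 := by
  rw [pulledControl, esControl_of_neg hm, zero_smul]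

theorem continuous_act {M : ℝ → RMat n} {v : ℝ → RVec n} {s : Set ℝ} (hM : Continuous M)
    (hv : ContinuousOn v s) : ContinuousOn (fun t => act (M t) (v t)) s := by
  have hc : Continuous fun r => toOp (M r) :=
    ((Matrix.toEuclideanCLM (n := Fin n) (𝕜 := ℝ)).toAlgEquiv.toLinearMap.toContinuousLinearMap
      ).continuous.comp hM
  exact hc.continuousOn.clm_apply hv

theorem continuous_pulledControl_max (hτ : 0 ≤ τ) (hε : 0 < ε) (hA : Continuous A)
    (hB : ContinuousOn B (Set.Ici 0)) (hζ : ContinuousOn ζ (Set.Ici 0)) :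
    Continuous fun m => pulledControl τ ε A B K ζ (max m 0) := by
  have hE : Continuous fun r => A (r + τ) := hA.comp (continuous_id.add continuous_const)
  have hZ : Continuous (adjointTransition fun r => A (r + τ)) :=
    continuous_iff_continuousAt.2 fun t => (hasDerivAt_adjointTransition hE t).continuousAt
  have hBτ : ContinuousOn (fun m => B (m + τ)) (Set.Ici 0) :=
    hB.comp (by fun_prop) fun m (hm : 0 ≤ m) => add_nonneg hm hτ
  have h : ContinuousOn (pulledControl τ ε A B K ζ) (Set.Ici 0) :=
    (continuousOn_esControl hε hζ).smul (continuous_act hZ hBτ)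
  exact h.comp_continuous (by fun_prop) fun m => Set.mem_Ici.2 (le_max_right m 0)

theorem pulledControl_eq_indicator : pulledControl τ ε A B K ζ =
    (Set.Ici (0 : ℝ)).indicator fun m => pulledControl τ ε A B K ζ (max m 0) := by
  ext1 m
  by_cases hm : 0 ≤ m
  · rw [Set.indicator_of_mem (by exact hm), max_eq_left hm]
  · rw [Set.indicator_of_notMem (by exact hm), pulledControl_of_neg (not_le.1 hm)]

theorem intervalIntegrable_pulledControl (hτ : 0 ≤ τ) (hε : 0 < ε) (hA : Continuous A)
    (hB : ContinuousOn B (Set.Ici 0)) (hζ : ContinuousOn ζ (Set.Ici 0)) (a b : ℝ) :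
    IntervalIntegrable (pulledControl τ ε A B K ζ) volume a b := by
  rw [intervalIntegrable_iff, pulledControl_eq_indicator]
  exact ((continuous_pulledControl_max hτ hε hA hB hζ).integrableOn_uIoc).indicator
    measurableSet_Ici

theorem integral_pulledControl (a : ℝ) :
    ∫ m in (0 : ℝ)..a, pulledControl τ ε A B K ζ m =
      pulledPrimitive τ ε A B K ζ (max a 0) := by
  rcases le_total 0 a with ha | ha
  · rw [max_eq_left ha, pulledPrimitive]
    refine intervalIntegral.integral_congr fun m hm => ?_
    rw [Set.uIcc_of_le ha] at hm
    simp only [max_eq_left hm.1]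
  -- the control vanishes for negative times, and the endpoint `0` is a null set
  · rw [max_eq_right ha, pulledPrimitive, intervalIntegral.integral_same]
    refine intervalIntegral.integral_zero_ae ?_
    have h0 : ∀ᵐ m : ℝ, m ≠ 0 := by simp [ae_iff]
    filter_upwards [h0] with m hm0 hm
    rw [Set.uIoc_of_ge ha] at hm
    exact pulledControl_of_neg (lt_of_le_of_ne hm.2 hm0)

theorem reductionTerm_eq (hτ : 0 ≤ τ) (hε : 0 < ε) (hA : Continuous A)
    (hB : ContinuousOn B (Set.Ici 0)) (hζ : ContinuousOn ζ (Set.Ici 0)) {t : ℝ} (ht : 0 ≤ t) :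
    reductionTerm τ ε A B K ζ t = act (stateTransition (fun r => A (r + τ)) (t - τ) 0)
      (pulledPrimitive τ ε A B K ζ t - pulledPrimitive τ ε A B K ζ (max (t - τ) 0)) := by
  have hE : Continuous fun r => A (r + τ) := hA.comp (continuous_id.add continuous_const)
  have hi := intervalIntegrable_pulledControl (K := K) hτ hε hA hB hζ
  have h1 : pulledPrimitive τ ε A B K ζ t - pulledPrimitive τ ε A B K ζ (max (t - τ) 0) =
      ∫ m in (t - τ)..t, pulledControl τ ε A B K ζ m := by
    rw [← intervalIntegral.integral_interval_sub_left (hi 0 t) (hi 0 (t - τ)),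
      integral_pulledControl, integral_pulledControl, max_eq_left ht]
  rw [h1, act, ← ContinuousLinearMap.intervalIntegral_comp_comm _ (hi _ _), reductionTerm]
  refine intervalIntegral.integral_congr fun m _ => ?_
  change esControl ε K ζ m • act (stateTransition _ _ _) _ = act _ (_ • act _ _)
  rw [act_vec_smul, ← act_mul, ← stateTransition_eq_mul hE]

theorem reductionTerm_zero (hτ : 0 ≤ τ) (hε : 0 < ε) (hA : Continuous A)
    (hB : ContinuousOn B (Set.Ici 0)) (hζ : ContinuousOn ζ (Set.Ici 0)) :
    reductionTerm τ ε A B K ζ 0 = 0 := by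
  rw [reductionTerm_eq hτ hε hA hB hζ le_rfl, zero_sub, max_eq_right (by linarith), sub_self]
  exact map_zero _

theorem hasDerivAt_pulledPrimitive (hτ : 0 ≤ τ) (hε : 0 < ε) (hA : Continuous A)
    (hB : ContinuousOn B (Set.Ici 0)) (hζ : ContinuousOn ζ (Set.Ici 0)) (t : ℝ) :
    HasDerivAt (pulledPrimitive τ ε A B K ζ) (pulledControl τ ε A B K ζ (max t 0)) t := by
  have hc := continuous_pulledControl_max (K := K) hτ hε hA hB hζ
  exact intervalIntegral.integral_hasDerivAt_right (hc.intervalIntegrable _ _)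
    (hc.stronglyMeasurableAtFilter _ _) hc.continuousAt

theorem hasDerivAt_pulledPrimitive_delay (hτ : 0 ≤ τ) (hε : 0 < ε) (hA : Continuous A)
    (hB : ContinuousOn B (Set.Ici 0)) (hζ : ContinuousOn ζ (Set.Ici 0)) {t : ℝ} (ht : t ≠ τ) :
    HasDerivAt (fun t => pulledPrimitive τ ε A B K ζ (max (t - τ) 0))
      (pulledControl τ ε A B K ζ (t - τ)) t := by
  rcases lt_or_gt_of_ne ht with h | h
  · rw [pulledControl_of_neg (sub_neg.2 h)]
    refine (hasDerivAt_const t (pulledPrimitive τ ε A B K ζ 0)).congr_of_eventuallyEq ?_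
    filter_upwards [Iio_mem_nhds h] with r hr
    rw [max_eq_right (sub_neg.2 hr).le]
  · have h1 := (hasDerivAt_pulledPrimitive (K := K) hτ hε hA hB hζ (t - τ)).comp_sub_const t τ
    rw [max_eq_left (sub_pos.2 h).le] at h1
    refine h1.congr_of_eventuallyEq ?_
    filter_upwards [Ioi_mem_nhds h] with r hr
    rw [max_eq_left (sub_pos.2 hr).le]

theorem hasDerivAt_stateTransition_delay (hA : Continuous A) (t : ℝ) :
    HasDerivAt (fun t => toOp (stateTransition (fun r => A (r + τ)) (t - τ) 0))
      (toOp (A t * stateTransition (fun r => A (r + τ)) (t - τ) 0)) t := by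
  have hE : Continuous fun r => A (r + τ) := hA.comp (continuous_id.add continuous_const)
  have h := ((isStateTransition_stateTransition hE 0).2 (t - τ)).comp_sub_const t τ
  rw [sub_add_cancel] at h
  simpa using hasDerivWithinAt_toOp h.hasDerivWithinAt (s := Set.univ)

/-- The reduction term absorbs the delayed input: `𝒯` solves
`𝒯' = A 𝒯 + B_new u(t) - B u(t - τ)` away from the jump of `u(t - τ)` at `t = τ`. -/
theorem hasDerivWithinAt_reductionTerm (hτ : 0 ≤ τ) (hε : 0 < ε) (hA : Continuous A)
    (hB : ContinuousOn B (Set.Ici 0)) (hζ : ContinuousOn ζ (Set.Ici 0)) {t : ℝ} (ht : 0 ≤ t)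
    (htτ : t ≠ τ) :
    HasDerivWithinAt (reductionTerm τ ε A B K ζ)
      (act (A t) (reductionTerm τ ε A B K ζ t) + esControl ε K ζ t • BNew τ A B t
        - esControl ε K ζ (t - τ) • B t) (Set.Ici 0) t := by
  have hE : Continuous fun r => A (r + τ) := hA.comp (continuous_id.add continuous_const)
  have h := (hasDerivAt_stateTransition_delay (τ := τ) hA t).clm_apply
    ((hasDerivAt_pulledPrimitive (K := K) hτ hε hA hB hζ t).sub
      (hasDerivAt_pulledPrimitive_delay (K := K) hτ hε hA hB hζ htτ))
  refine (h.hasDerivWithinAt.congr_deriv ?_).congr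
    (fun s hs => reductionTerm_eq hτ hε hA hB hζ hs) (reductionTerm_eq hτ hε hA hB hζ ht)
  rw [reductionTerm_eq hτ hε hA hB hζ ht, max_eq_left ht, ← act_mul, map_sub, add_sub_assoc]
  congr 1
  rw [pulledControl, pulledControl, map_smul, map_smul]
  change esControl ε K ζ t • act (stateTransition _ _ _) (act _ _) -
    esControl ε K ζ (t - τ) • act (stateTransition _ _ _) (act _ _) = _
  rw [← act_mul, ← act_mul, ← stateTransition_eq_mul hE, ← stateTransition_eq_mul hE,
    (isStateTransition_stateTransition hE _).1, sub_add_cancel, act_one]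
  rfl

theorem continuousOn_reductionTerm (hτ : 0 ≤ τ) (hε : 0 < ε) (hA : Continuous A)
    (hB : ContinuousOn B (Set.Ici 0)) (hζ : ContinuousOn ζ (Set.Ici 0)) :
    ContinuousOn (reductionTerm τ ε A B K ζ) (Set.Ici 0) := by
  have hJ : Continuous (pulledPrimitive τ ε A B K ζ) := continuous_iff_continuousAt.2 fun t =>
    (hasDerivAt_pulledPrimitive hτ hε hA hB hζ t).continuousAt
  have hY : Continuous fun t => toOp (stateTransition (fun r => A (r + τ)) (t - τ) 0) :=
    continuous_iff_continuousAt.2 fun t =>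
      (hasDerivAt_stateTransition_delay (τ := τ) hA t).continuousAt
  have h : Continuous fun t => toOp (stateTransition (fun r => A (r + τ)) (t - τ) 0)
      (pulledPrimitive τ ε A B K ζ t - pulledPrimitive τ ε A B K ζ (max (t - τ) 0)) :=
    hY.clm_apply (hJ.sub (hJ.comp (by fun_prop)))
  exact h.continuousOn.congr fun t ht => reductionTerm_eq hτ hε hA hB hζ ht

/-- A continuous derivative at all nonnegative times but one is a derivative there as well. -/
theorem hasDerivWithinAt_Ici_of_ne {F : Type*} [NormedAddCommGroup F] [NormedSpace ℝ F]
    {f f' : ℝ → F} (hτ : 0 < τ) (hf : ContinuousOn f (Set.Ici 0))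
    (hf' : ContinuousOn f' (Set.Ici 0))
    (hd : ∀ t, 0 ≤ t → t ≠ τ → HasDerivWithinAt f (f' t) (Set.Ici 0) t) {t : ℝ} (ht : 0 ≤ t) :
    HasDerivWithinAt f (f' t) (Set.Ici 0) t := by
  by_cases htτ : t = τ
  swap
  · exact hd t ht htτ
  subst htτ
  have hat : ∀ r, 0 < r → r ≠ t → HasDerivAt f (f' r) r := fun r hr hrt =>
    (hd r hr.le hrt).hasDerivAt (Ici_mem_nhds hr)
  have hc : ContinuousAt f t := hf.continuousAt (Ici_mem_nhds hτ)
  have hc' : ContinuousAt f' t := hf'.continuousAt (Ici_mem_nhds hτ)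
  have hr : HasDerivWithinAt f (f' t) (Set.Ici t) t := by
    refine hasDerivWithinAt_Ici_of_tendsto_deriv (s := Set.Ioi t)
      (fun r hr => (hat r (hτ.trans hr) (ne_of_gt hr)).differentiableAt.differentiableWithinAt)
      hc.continuousWithinAt self_mem_nhdsWithin ?_
    refine (hc'.tendsto.mono_left nhdsWithin_le_nhds).congr' ?_
    filter_upwards [self_mem_nhdsWithin] with r hr
    exact (hat r (hτ.trans hr) (ne_of_gt hr)).deriv.symm
  have hl : HasDerivWithinAt f (f' t) (Set.Iic t) t := by
    refine hasDerivWithinAt_Iic_of_tendsto_deriv (s := Set.Ioo 0 t)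
      (fun r hr => (hat r hr.1 (ne_of_lt hr.2)).differentiableAt.differentiableWithinAt)
      hc.continuousWithinAt (Ioo_mem_nhdsLT hτ) ?_
    refine (hc'.tendsto.mono_left nhdsWithin_le_nhds).congr' ?_
    filter_upwards [Ioo_mem_nhdsLT hτ] with r hr
    exact (hat r hr.1 (ne_of_lt hr.2)).deriv.symm
  have := hl.union hr
  rw [Set.Iic_union_Ici] at this
  exact this.mono (Set.subset_univ _)

end Delay

/-! ### Reduction of the delayed system -/

section ClosedLoop

open Real

variable {n : ℕ} {τ ε : ℝ} {A : ℝ → RMat n} {B : ℝ → RVec n} {K : RMat n} {x ζ : ℝ → RVec n}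
  {q pLow pBar ABar : ℝ}

theorem continuousOn_reduced_rhs (hε : 0 < ε) (hA : Continuous A)
    (hBn : ContinuousOn (BNew τ A B) (Set.Ici 0)) (hζ : ContinuousOn ζ (Set.Ici 0)) :
    ContinuousOn (fun t => act (A t) (ζ t) + esControl ε K ζ t • BNew τ A B t) (Set.Ici 0) :=
  (continuous_act hA hζ).add ((continuousOn_esControl hε hζ).smul hBn)

theorem isReducedSolution_iff (hε : 0 < ε) :
    (reducedData τ A B K q pLow pBar ABar).IsReducedSolution ε ζ ↔
      ∀ t, 0 ≤ t → HasDerivWithinAt ζ (act (A t) (ζ t) + esControl ε K ζ t • BNew τ A B t)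
        (Set.Ici 0) t := by
  refine forall₂_congr fun t ht => ?_
  rw [esControl_of_nonneg hε ht]
  rfl

/-- The reduction: along a closed loop solution, `ζ` solves the undelayed system. -/
theorem IsClosedLoopSolution.isReducedSolution (h : IsClosedLoopSolution τ ε A B K x ζ)
    (hτ : 0 < τ) (hε : 0 < ε) (hA : Continuous A) (hB : ContinuousOn B (Set.Ici 0))
    (hBn : ContinuousOn (BNew τ A B) (Set.Ici 0)) :
    (reducedData τ A B K q pLow pBar ABar).IsReducedSolution ε ζ := by
  rw [isReducedSolution_iff hε]
  intro t ht
  refine hasDerivWithinAt_Ici_of_ne (τ := τ) hτ h.continuousOn_zeta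
    (continuousOn_reduced_rhs hε hA hBn h.continuousOn_zeta) (fun s hs hsτ => ?_) ht
  have h1 := (h.ode s hs hsτ).add
    (hasDerivWithinAt_reductionTerm (K := K) hτ.le hε hA hB h.continuousOn_zeta hs hsτ)
  refine (h1.congr_deriv ?_).congr (fun r hr => h.zeta_eq r hr) (h.zeta_eq s hs)
  rw [h.zeta_eq s hs, act_vec_add]
  abel

theorem IsClosedLoopSolution.zeta_zero (h : IsClosedLoopSolution τ ε A B K x ζ)
    (hτ : 0 < τ) (hε : 0 < ε) (hA : Continuous A) (hB : ContinuousOn B (Set.Ici 0)) :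
    ζ 0 = x 0 := by
  rw [h.zeta_eq 0 le_rfl, reductionTerm_zero hτ.le hε hA hB h.continuousOn_zeta, add_zero]

/-- Every solution of the undelayed system comes from a closed loop solution. -/
theorem ESData.IsReducedSolution.isClosedLoopSolution
    (h : (reducedData τ A B K q pLow pBar ABar).IsReducedSolution ε ζ)
    (hτ : 0 < τ) (hε : 0 < ε) (hA : Continuous A) (hB : ContinuousOn B (Set.Ici 0)) :
    IsClosedLoopSolution τ ε A B K (fun t => ζ t - reductionTerm τ ε A B K ζ t) ζ := by
  have hζ : ContinuousOn ζ (Set.Ici 0) := fun t ht => (h t ht).continuousWithinAt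
  rw [isReducedSolution_iff hε] at h
  refine ⟨hζ.sub (continuousOn_reductionTerm hτ.le hε hA hB hζ), hζ, fun t _ => by abel,
    fun t ht htτ => ?_⟩
  refine ((h t ht).sub (hasDerivWithinAt_reductionTerm hτ.le hε hA hB hζ ht htτ)).congr_deriv ?_
  rw [act_vec_sub]
  abel

end ClosedLoop

/-! ### Global existence -/

section GlobalExistence

open Set NNReal

variable {V : Type*} [NormedAddCommGroup V] [NormedSpace ℝ V]

/-- Solutions on the successive intervals `[k h, (k+1) h]`, each starting where the previous one
ends, glue to a solution on `[0, ∞)`. -/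
theorem exists_hasDerivWithinAt_Ici_of_uniform_step {F : ℝ → V → V} {h : ℝ} (hh : 0 < h)
    (hloc : ∀ t₀, 0 ≤ t₀ → ∀ x₀, ∃ g : ℝ → V, g t₀ = x₀ ∧
      ∀ t ∈ Icc t₀ (t₀ + h), HasDerivWithinAt g (F t (g t)) (Icc t₀ (t₀ + h)) t) (x₀ : V) :
    ∃ ζ : ℝ → V, ζ 0 = x₀ ∧ ∀ t, 0 ≤ t → HasDerivWithinAt ζ (F t (ζ t)) (Ici 0) t := by
  have hloc' : ∀ (k : ℕ) (x : V), ∃ g : ℝ → V, g (k * h) = x ∧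
      ∀ t ∈ Icc (k * h) (k * h + h), HasDerivWithinAt g (F t (g t)) (Icc (k * h) (k * h + h)) t :=
    fun k x => hloc (k * h) (by positivity) x
  choose g hg0 hg using hloc'
  let X : ℕ → V := fun k => Nat.rec x₀ (fun k x => g k x ((k + 1 : ℕ) * h)) k
  have hX : ∀ k, X (k + 1) = g k (X k) ((k + 1 : ℕ) * h) := fun k => rfl
  let ζ : ℝ → V := fun t => g ⌊t / h⌋₊ (X ⌊t / h⌋₊) t
  have hsucc : ∀ k : ℕ, (k : ℝ) * h + h = ((k + 1 : ℕ) : ℝ) * h := fun k => by push_cast; ring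
  have hζ : ∀ k : ℕ, EqOn ζ (g k (X k)) (Icc (k * h) (k * h + h)) := by
    intro k t ht
    rcases ht.2.eq_or_lt with h1 | h1
    · have hk : ⌊t / h⌋₊ = k + 1 := by
        rw [h1, hsucc, mul_div_cancel_right₀ _ hh.ne', Nat.floor_natCast]
      simp only [ζ, hk]
      rw [h1, hsucc, hg0, hX]
    · have hk : ⌊t / h⌋₊ = k := by
        rw [Nat.floor_eq_iff (div_nonneg (le_trans (by positivity) ht.1) hh.le),
          le_div_iff₀ hh, div_lt_iff₀ hh]
        exact ⟨ht.1, by linarith⟩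
      simp only [ζ, hk]
  have hd : ∀ k : ℕ, ∀ t ∈ Icc (k * h) (k * h + h),
      HasDerivWithinAt ζ (F t (ζ t)) (Icc (k * h) (k * h + h)) t := by
    intro k t ht
    have h1 := (hg k (X k) t ht).congr (fun s hs => hζ k hs) (hζ k ht)
    rwa [← hζ k ht] at h1
  refine ⟨ζ, ?_, fun t ht => ?_⟩
  · have := hζ 0 (x := 0) (by simp [hh.le])
    rw [this]
    have h0 := hg0 0 x₀
    rwa [Nat.cast_zero, zero_mul] at h0
  · obtain ⟨k, hk1, hk2⟩ : ∃ k : ℕ, k * h ≤ t ∧ t < k * h + h := by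
      refine ⟨⌊t / h⌋₊, ?_, ?_⟩
      · rw [← le_div_iff₀ hh]; exact Nat.floor_le (by positivity)
      · have := Nat.lt_floor_add_one (t / h)
        rw [div_lt_iff₀ hh] at this
        linarith
    have h1 := hd k t ⟨hk1, hk2.le⟩
    rcases k with _ | j
    · refine h1.mono_of_mem_nhdsWithin ?_
      simp only [Nat.cast_zero, zero_mul, zero_add] at hk2 ⊢
      rw [← Ici_inter_Iic]
      exact Filter.inter_mem self_mem_nhdsWithin (mem_nhdsWithin_of_mem_nhds (Iic_mem_nhds hk2))
    rcases hk1.eq_or_lt with h2 | h2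
    · have h3 := hd j t ⟨by rw [← h2, ← hsucc]; linarith, by rw [← h2, hsucc]⟩
      have h4 := h3.union h1
      rw [hsucc j, Icc_union_Icc_eq_Icc (by rw [← hsucc]; linarith) (by linarith)] at h4
      refine (h4.hasDerivAt (Icc_mem_nhds ?_ hk2)).hasDerivWithinAt
      rw [← h2, ← hsucc]; linarith
    · exact (h1.hasDerivAt (Icc_mem_nhds h2 hk2)).hasDerivWithinAt

/-- Global existence for locally Lipschitz fields of linear growth: the growth bound gives a length
of the Picard-Lindelöf interval that does not depend on the initial value. -/
theorem exists_hasDerivWithinAt_Ici_of_linear_growth [CompleteSpace V] {F : ℝ → V → V} {C : ℝ}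
    (hF : ∀ x, ContinuousOn (fun t => F t x) (Ici 0))
    (hlip : ∀ R : ℝ, ∃ L : ℝ≥0, ∀ t, 0 ≤ t → LipschitzOnWith L (F t) (Metric.closedBall 0 R))
    (hgrowth : ∀ t, 0 ≤ t → ∀ x, ‖F t x‖ ≤ C * (1 + ‖x‖)) (x₀ : V) :
    ∃ ζ : ℝ → V, ζ 0 = x₀ ∧ ∀ t, 0 ≤ t → HasDerivWithinAt ζ (F t (ζ t)) (Ici 0) t := by
  have hC : 0 ≤ C := by
    have := (norm_nonneg _).trans (hgrowth 0 le_rfl 0)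
    simpa using this
  refine exists_hasDerivWithinAt_Ici_of_uniform_step (h := (2 * C + 1)⁻¹) (by positivity)
    (fun t₀ ht₀ y₀ => ?_) x₀
  -- on the ball of radius `1 + ‖y₀‖` about `y₀` the field is at most `2 C (1 + ‖y₀‖)`
  set h := (2 * C + 1)⁻¹ with hh
  have hh0 : 0 < h := by positivity
  obtain ⟨L, hL⟩ := hlip (‖y₀‖ + (1 + ‖y₀‖))
  have hsub : Metric.closedBall y₀ (1 + ‖y₀‖) ⊆ Metric.closedBall 0 (‖y₀‖ + (1 + ‖y₀‖)) :=
    Metric.closedBall_subset_closedBall' (by rw [dist_zero_right]; linarith)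
  have hpl : IsPicardLindelof F (tmin := t₀) (tmax := t₀ + h) ⟨t₀, by simp [hh0.le]⟩ y₀
      (1 + ‖y₀‖₊) 0 (Real.toNNReal (2 * C * (1 + ‖y₀‖))) L := by
    constructor
    · intro t ht
      exact (hL t (ht₀.trans ht.1)).mono (by simpa using hsub)
    · intro x _
      exact (hF x).mono fun t ht => ht₀.trans ht.1
    · intro t ht x hx
      rw [Real.coe_toNNReal _ (by positivity)]
      refine (hgrowth t (ht₀.trans ht.1) x).trans ?_
      have hx' := hsub (by simpa using hx)
      rw [mem_closedBall_zero_iff] at hx'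
      calc C * (1 + ‖x‖) ≤ C * (1 + (‖y₀‖ + (1 + ‖y₀‖))) := by gcongr
        _ = _ := by ring
    · rw [Real.coe_toNNReal _ (by positivity)]
      simp only [add_sub_cancel_left, sub_self, NNReal.coe_add, NNReal.coe_one, coe_nnnorm,
        NNReal.coe_zero, sub_zero, max_eq_left hh0.le]
      have h1 : 2 * C * h ≤ 1 := by
        rw [hh, ← div_eq_mul_inv, div_le_one (by positivity)]
        linarith
      have h2 := mul_le_mul_of_nonneg_right h1 (by positivity : 0 ≤ 1 + ‖y₀‖)
      linarith
  exact hpl.exists_eq_forall_mem_Icc_hasDerivWithinAt₀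

end GlobalExistence

/-! ### Existence for the undelayed system -/

section ReducedExistence

open Real

variable {n : ℕ}

/-- The undelayed closed loop system has a global solution. -/
theorem ESData.exists_isReducedSolution {d : ESData n} (hp : d.PlantBounds) {ε : ℝ} (hε : 0 < ε)
    (x₀ : RVec n) : ∃ ζ, d.IsReducedSolution ε ζ ∧ ζ 0 = x₀ := by
  have he := oscAmplitude_pos hε
  set e := oscAmplitude ε with hedef
  have hA0 := hp.ABar_nonneg
  have hB0 := hp.BBar_pos
  refine Exists.imp (fun ζ h => ⟨h.2, h.1⟩) (exists_hasDerivWithinAt_Ici_of_linear_growth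
    (F := fun t x => act (d.A t) x +
      (e⁻¹ * cos ((e ^ 2)⁻¹ * t + inner ℝ x (toOp d.K x))) • d.B t)
    (C := d.ABar + e⁻¹ * d.BBar) ?_ ?_ ?_ x₀)
  · intro x
    have h1 : ContinuousOn (fun t => act (d.A t) x) (Set.Ici 0) := by
      have h2 : ContinuousOn (fun r => toOp (d.A r)) (Set.Ici 0) :=
        ((Matrix.toEuclideanCLM (n := Fin n) (𝕜 := ℝ)).toAlgEquiv.toLinearMap.toContinuousLinearMap
          ).continuous.comp_continuousOn hp.continuousOn_A
      exact h2.clm_apply continuousOn_const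
    have h2 : Continuous fun t : ℝ =>
      e⁻¹ * cos ((e ^ 2)⁻¹ * t + inner ℝ x (toOp d.K x)) := by fun_prop
    exact h1.add (h2.continuousOn.smul hp.differentiableOn_B.continuousOn)
  · intro R
    refine ⟨Real.toNNReal (d.ABar + e⁻¹ * (2 * |R| * ‖d.K‖) * d.BBar), fun t ht => ?_⟩
    refine LipschitzOnWith.of_dist_le_mul fun x hx y hy => ?_
    rw [mem_closedBall_zero_iff] at hx hy
    rw [Real.coe_toNNReal _ (by positivity), dist_eq_norm, dist_eq_norm]
    have e1 : act (d.A t) x + (e⁻¹ * cos ((e ^ 2)⁻¹ * t + inner ℝ x (toOp d.K x))) • d.B t -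
        (act (d.A t) y + (e⁻¹ * cos ((e ^ 2)⁻¹ * t + inner ℝ y (toOp d.K y))) • d.B t) =
        act (d.A t) (x - y) + (e⁻¹ * (cos ((e ^ 2)⁻¹ * t + inner ℝ x (toOp d.K x)) -
          cos ((e ^ 2)⁻¹ * t + inner ℝ y (toOp d.K y)))) • d.B t := by
      rw [act_vec_sub]; module
    have e2 : (inner ℝ x (toOp d.K x) : ℝ) - inner ℝ y (toOp d.K y) =
        inner ℝ x (act d.K (x - y)) + inner ℝ (x - y) (act d.K y) := by
      rw [act_vec_sub, inner_sub_right, inner_sub_left]; ring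
    have e3 : |(inner ℝ x (toOp d.K x) : ℝ) - inner ℝ y (toOp d.K y)| ≤
        2 * |R| * ‖d.K‖ * ‖x - y‖ := by
      rw [e2]
      have hR := le_abs_self R
      have a1 : |(inner ℝ x (act d.K (x - y)) : ℝ)| ≤ |R| * (‖d.K‖ * ‖x - y‖) :=
        (abs_real_inner_le_norm _ _).trans (mul_le_mul (hx.trans hR) (norm_act_le _ _)
          (norm_nonneg _) (abs_nonneg _))
      have a2 : |(inner ℝ (x - y) (act d.K y) : ℝ)| ≤ ‖x - y‖ * (‖d.K‖ * |R|) :=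
        (abs_real_inner_le_norm _ _).trans (mul_le_mul_of_nonneg_left
          ((norm_act_le _ _).trans (mul_le_mul_of_nonneg_left (hy.trans hR) (norm_nonneg _)))
          (norm_nonneg _))
      refine (abs_add_le _ _).trans ((add_le_add a1 a2).trans (le_of_eq ?_))
      ring
    have e4 : |cos ((e ^ 2)⁻¹ * t + inner ℝ x (toOp d.K x)) -
        cos ((e ^ 2)⁻¹ * t + inner ℝ y (toOp d.K y))| ≤ 2 * |R| * ‖d.K‖ * ‖x - y‖ := by
      refine le_trans ?_ e3
      have := Real.lipschitzWith_cos.dist_le_mul ((e ^ 2)⁻¹ * t + inner ℝ x (toOp d.K x))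
        ((e ^ 2)⁻¹ * t + inner ℝ y (toOp d.K y))
      simpa [Real.dist_eq] using this
    rw [e1]
    have b1 : ‖act (d.A t) (x - y)‖ ≤ d.ABar * ‖x - y‖ :=
      (norm_act_le _ _).trans (mul_le_mul_of_nonneg_right (hp.norm_A_le t ht) (norm_nonneg _))
    have b2 : ‖(e⁻¹ * (cos ((e ^ 2)⁻¹ * t + inner ℝ x (toOp d.K x)) -
          cos ((e ^ 2)⁻¹ * t + inner ℝ y (toOp d.K y)))) • d.B t‖ ≤
        e⁻¹ * (2 * |R| * ‖d.K‖ * ‖x - y‖) * d.BBar := by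
      rw [norm_smul, Real.norm_eq_abs, abs_mul, abs_of_pos (inv_pos.2 he)]
      exact mul_le_mul (mul_le_mul_of_nonneg_left e4 (inv_pos.2 he).le) (hp.norm_B_le t ht)
        (norm_nonneg _) (by positivity)
    refine (norm_add_le _ _).trans ((add_le_add b1 b2).trans (le_of_eq ?_))
    ring
  · intro t ht x
    have b1 : ‖act (d.A t) x‖ ≤ d.ABar * ‖x‖ :=
      (norm_act_le _ _).trans (mul_le_mul_of_nonneg_right (hp.norm_A_le t ht) (norm_nonneg _))
    have b2 : ‖(e⁻¹ * cos ((e ^ 2)⁻¹ * t + inner ℝ x (toOp d.K x))) • d.B t‖ ≤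
        e⁻¹ * d.BBar := by
      rw [norm_smul, Real.norm_eq_abs, abs_mul, abs_of_pos (inv_pos.2 he)]
      exact mul_le_mul (mul_le_of_le_one_right (inv_pos.2 he).le (abs_cos_le_one _))
        (hp.norm_B_le t ht) (norm_nonneg _) (inv_pos.2 he).le
    refine (norm_add_le _ _).trans ((add_le_add b1 b2).trans ?_)
    have : 0 ≤ e⁻¹ * d.BBar * ‖x‖ := by positivity
    linarith

end ReducedExistence

/-! ### Behaviour for large times and small periods -/

section Asymptotics

open Real

variable {n : ℕ}

namespace ESData

variable {d : ESData n} {P : ℝ → RMat n} {pBarBar σ₀ ε : ℝ} {ζ : ℝ → RVec n}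

theorem oscAmplitude_le_sqrt (hε : 0 ≤ ε) : oscAmplitude ε ≤ √ε := by
  refine sqrt_le_sqrt (div_le_self hε ?_)
  have := pi_gt_three
  linarith

/-- The constant `c₁`, and with it `ξ_s`, is of order `√ε`, uniformly in `ε < 1`. -/
theorem SmallParameter.c₁_le (hδ : d.deltaBar = 0) (hp : d.PlantBounds) (hpb : 0 ≤ d.pBar)
    (hs : d.SmallParameter σ₀ ε) (hε : 0 < ε) (hε1 : ε < 1) :
    d.c₁ ε ≤ 2 * d.pBar * (2 * (supNorm (fun t => act (d.H t) (d.B t)) +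
      supNorm (fun t => act (d.DK t) (d.B t)) + d.DBBar
        + d.BBar * (2 * d.ABar * ‖d.K‖) * (2 * d.BBar ^ 2))) * √ε := by
  rw [c₁_eq hδ hε]
  have he := oscAmplitude_pos hε
  have he1 := oscAmplitude_le_sqrt hε.le
  have hA := hp.ABar_nonneg
  have hD := hp.DBBar_nonneg
  have hB := hp.BBar_pos
  have h1 := supNorm_nonneg (fun t => act (d.H t) (d.B t))
  have h2 := supNorm_nonneg (fun t => act (d.DK t) (d.B t))
  generalize supNorm (fun t => act (d.H t) (d.B t)) = x at h1 ⊢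
  generalize supNorm (fun t => act (d.DK t) (d.B t)) = y at h2 ⊢
  have hσ := hs.half_le hε
  have hsq : oscAmplitude ε ^ 2 ≤ 1 :=
    pow_le_one₀ he.le (he1.trans (sqrt_le_one.2 hε1.le))
  calc 2 * d.pBar * ((1 + oscAmplitude ε ^ 2 / 2 * d.normDK) * (oscAmplitude ε * (x + y + d.DBBar
        + d.BBar * (2 * d.ABar * ‖d.K‖) * (2 * d.BBar ^ 2 * oscAmplitude ε ^ 2))))
      ≤ 2 * d.pBar * (2 * (√ε * (x + y + d.DBBar
        + d.BBar * (2 * d.ABar * ‖d.K‖) * (2 * d.BBar ^ 2 * 1)))) := by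
        gcongr
        linarith
    _ = _ := by ring

theorem tendsto_stateBound (hp : d.PlantBounds)
    (hl : d.LyapunovBounds P pBarBar) (hε : 0 < ε) (hs : d.SmallParameter σ₀ ε) {ξ₀ : ℝ}
    (h₁ : ξ₀ < d.xiL ε) :
    Filter.Tendsto (d.stateBound ε ξ₀) Filter.atTop
      (nhds (d.lam ε / √d.pLow * √(d.xiS ε) + d.BBar * oscAmplitude ε)) := by
  have hr : 0 < d.r₀ ε := by
    have h2 := hs.c₃_add_pos hp hl.pBar_pos.le hε
    have h3 := sub_pos.2 (hs.xiS_lt_xiL hp hl hε)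
    have h4 := hl.pLow_pos
    exact mul_pos (by positivity) (by linarith)
  exact (((tendsto_logisticCurve (ξs := d.xiS ε) h₁ hr).sqrt).const_mul _).add_const _

/-- Solutions of the reduced system are eventually of order `ε^{1/4}`, uniformly in `ε < 1`. -/
theorem exists_eventually_norm_le (hδ : d.deltaBar = 0) (hp : d.PlantBounds)
    (hl : d.LyapunovBounds P pBarBar) (σ₀ : ℝ) : ∃ M : ℝ, 0 < M ∧ ∀ ε : ℝ, 0 < ε → ε < 1 →
      d.SmallParameter σ₀ ε → ∀ ζ, d.IsReducedSolution ε ζ → ‖ζ 0‖ ≤ σ₀ →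
        ∀ᶠ t in Filter.atTop, ‖ζ t‖ ≤ M * ε ^ (1 / 4 : ℝ) := by
  obtain ⟨C, hC0, hC⟩ : ∃ C : ℝ, 0 ≤ C ∧ ∀ ε, 0 < ε → ε < 1 → d.SmallParameter σ₀ ε →
      d.c₁ ε ≤ C * √ε := by
    refine ⟨_, ?_, fun ε h0 h1 hs => hs.c₁_le hδ hp hl.pBar_pos.le h0 h1⟩
    have h1 := supNorm_nonneg (fun t => act (d.H t) (d.B t))
    have h2 := supNorm_nonneg (fun t => act (d.DK t) (d.B t))
    generalize supNorm (fun t => act (d.H t) (d.B t)) = x at h1 ⊢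
    generalize supNorm (fun t => act (d.DK t) (d.B t)) = y at h2 ⊢
    have := hp.ABar_nonneg
    have := hp.DBBar_nonneg
    have := hp.BBar_pos
    have := hl.pBar_pos
    positivity
  have hpl := hl.pLow_pos
  have hq := hl.q_pos
  have hB := hp.BBar_pos
  refine ⟨2 / √d.pLow * √(2 * C / d.q) + d.BBar + 1, by positivity,
    fun ε hε hε1 hs ζ hζ h0 => ?_⟩
  set η := ε ^ (1 / 4 : ℝ) with hη
  have hη0 : 0 < η := rpow_pos_of_pos hε _
  have hη1 : η ≤ 1 := rpow_le_one hε.le hε1.le (by norm_num)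
  have hη2 : √ε = η ^ 2 := by
    rw [sqrt_eq_rpow, hη, ← rpow_natCast, ← rpow_mul hε.le]; norm_num
  have hxi : √(d.xiS ε) ≤ √(2 * C / d.q) * η := by
    rw [← sqrt_sq hη0.le, ← sqrt_mul (by positivity)]
    refine sqrt_le_sqrt ((xiS_le hδ hp hl hε).trans ?_)
    have h1 := hC ε hε hε1 hs
    rw [hη2] at h1
    calc 2 * d.c₁ ε / d.q ≤ 2 * (C * η ^ 2) / d.q := by gcongr
      _ = _ := by ring
  have he : oscAmplitude ε ≤ η := by
    refine (oscAmplitude_le_sqrt hε.le).trans ?_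
    rw [hη2]
    nlinarith
  have hlam := hs.lam_le_two hε
  have hlim : d.lam ε / √d.pLow * √(d.xiS ε) + d.BBar * oscAmplitude ε <
      (2 / √d.pLow * √(2 * C / d.q) + d.BBar + 1) * η := by
    calc d.lam ε / √d.pLow * √(d.xiS ε) + d.BBar * oscAmplitude ε
        ≤ 2 / √d.pLow * (√(2 * C / d.q) * η) + d.BBar * η := by gcongr
      _ < _ := by linarith
  obtain ⟨ξ₀, h₀, h₁⟩ := exists_between (max_lt (hs.xiS_lt_xiL hp hl hε) hs.fourth)
  filter_upwards [(tendsto_stateBound hp hl hε hs h₁).eventually_lt_const hlim,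
    Filter.eventually_ge_atTop 0] with t ht1 ht2
  exact (hζ.norm_le_stateBound hδ hp hl hε hs h0 h₀ h₁ ht2).trans ht1.le

end ESData

variable {τ ε : ℝ} {A : ℝ → RMat n} {B : ℝ → RVec n} {K : RMat n} {ζ : ℝ → RVec n}
  {q pLow pBar ABar : ℝ}

/-- Integration of the fast oscillation by parts: over a window on which `‖ζ‖ ≤ ρ`, the reduction
term is of order `e + ρ`, although the control has amplitude `1 / e`. -/
theorem norm_reductionTerm_le (hτ : 0 < τ) (hε : 0 < ε) (hA : Continuous A)
    (hB : DifferentiableOn ℝ B (Set.Ici 0)) (hK : K.IsHermitian)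
    {a b b' β k ρ φ : ℝ} (hAb : ∀ t, ‖A t‖ ≤ a) (hBb : ∀ t, 0 ≤ t → ‖B t‖ ≤ b)
    (hB'b : ∀ t, 0 ≤ t → ‖dot B t‖ ≤ b') (hβ : ∀ t, 0 ≤ t → ‖BNew τ A B t‖ ≤ β) (hk : ‖K‖ ≤ k)
    (hφ : ∀ t s, |t - s| ≤ τ → ‖delayTransition τ A t s‖ ≤ φ)
    (hζ : (reducedData τ A B K q pLow pBar ABar).IsReducedSolution ε ζ) {t : ℝ} (ht : τ ≤ t)
    (hρ : ∀ m, t - τ ≤ m → m ≤ t → ‖ζ m‖ ≤ ρ) :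
    ‖reductionTerm τ ε A B K ζ t‖ ≤ 2 * (oscAmplitude ε * (φ * b)) +
      (oscAmplitude ε * (φ * (a * b + b')) +
        (oscAmplitude ε * (2 * a * k * ρ ^ 2) + 2 * β * k * ρ) * (φ * b)) * τ := by
  have hE : Continuous fun r => A (r + τ) := hA.comp (continuous_id.add continuous_const)
  have hζc : ContinuousOn ζ (Set.Ici 0) := fun t ht => (hζ t ht).continuousWithinAt
  have he := oscAmplitude_pos hε
  have ht0 : 0 ≤ t - τ := sub_nonneg.2 ht
  have ha : 0 ≤ a := (norm_nonneg _).trans (hAb 0)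
  have hb : 0 ≤ b := (norm_nonneg _).trans (hBb 0 le_rfl)
  have hb' : 0 ≤ b' := (norm_nonneg _).trans (hB'b 0 le_rfl)
  have hβ0 : 0 ≤ β := (norm_nonneg _).trans (hβ 0 le_rfl)
  have hk0 : 0 ≤ k := (norm_nonneg _).trans hk
  have hφ0 : 0 ≤ φ := (norm_nonneg _).trans (hφ 0 0 (by simpa using hτ.le))
  have hρ0 : 0 ≤ ρ := (norm_nonneg _).trans (hρ t (by linarith) le_rfl)
  have hKs : ∀ u v : RVec n, (inner ℝ u (toOp K v) : ℝ) = inner ℝ (toOp K u) v :=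
    inner_act_comm_of_isHermitian hK
  set e := oscAmplitude ε with hedef
  set θ := oscPhase (toOp K) e ζ with hθdef
  set Y := stateTransition (fun r => A (r + τ)) (t - τ) 0 with hY
  set G : ℝ → RVec n := fun m => act (delayTransition τ A (t - τ) m) (B (m + τ)) with hG
  set G' : ℝ → RVec n := fun m => act (delayTransition τ A (t - τ) m) (dot B (m + τ))
    - act (delayTransition τ A (t - τ) m) (act (A (m + τ)) (B (m + τ))) with hG'
  set ν : ℝ → ℝ := fun m => 2 * inner ℝ (act (A m) (ζ m)) (act K (ζ m)) +
        2 * e⁻¹ * cos (θ m) * inner ℝ (BNew τ A B m) (act K (ζ m)) with hν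
  have hGd : ∀ m, 0 ≤ m → HasDerivAt G (G' m) m := by
    intro m hm
    have h1 : HasDerivAt (fun m => delayTransition τ A (t - τ) m)
        (-(delayTransition τ A (t - τ) m * A (m + τ))) m := by
      have h2 := (hasDerivAt_adjointTransition hE m).const_mul Y
      rw [mul_neg, ← mul_assoc, hY, ← stateTransition_eq_mul hE] at h2
      exact h2.congr_of_eventuallyEq (Filter.Eventually.of_forall fun r =>
        stateTransition_eq_mul hE _ _)
    have h3 : HasDerivAt (fun m => B (m + τ)) (dot B (m + τ)) m := by
      have h4 : HasDerivAt B (dot B (m + τ)) (m + τ) :=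
        (hB (m + τ) (Set.mem_Ici.2 (by linarith))).hasDerivWithinAt.hasDerivAt
          (Ici_mem_nhds (by linarith))
      exact h4.comp_add_const m τ
    have h5 : HasDerivAt (fun r => toOp (delayTransition τ A (t - τ) r))
        (toOp (-(delayTransition τ A (t - τ) m * A (m + τ)))) m := by
      simpa using hasDerivWithinAt_toOp h1.hasDerivWithinAt (s := Set.univ)
    refine (h5.clm_apply h3).congr_deriv ?_
    have h6 : toOp (-(delayTransition τ A (t - τ) m * A (m + τ))) (B (m + τ)) =
        -act (delayTransition τ A (t - τ) m) (act (A (m + τ)) (B (m + τ))) := by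
      rw [← act_mul]
      exact act_neg _ _
    rw [h6, add_comm, ← sub_eq_add_neg]
  have hθd : ∀ m, 0 ≤ m → HasDerivWithinAt θ ((e ^ 2)⁻¹ + ν m) (Set.Ici 0) m := fun m hm =>
    hasDerivWithinAt_oscPhase (A := toOp (A m)) hKs (hζ m hm)
  -- the primitive of the integrand, minus its leading oscillation `e sin(θ) G`
  set D : ℝ → RVec n := fun r => toOp Y (pulledPrimitive τ ε A B K ζ r) - (e * sin (θ r)) • G r
    with hD
  have hDd : ∀ r, 0 ≤ r → HasDerivWithinAt D
      (-((e * sin (θ r)) • G' r + (e * cos (θ r) * ν r) • G r)) (Set.Ici 0) r := by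
    intro r hr
    have h1 := ((toOp Y).hasFDerivAt.comp_hasDerivAt r
      (hasDerivAt_pulledPrimitive (K := K) hτ.le hε hA hB.continuousOn hζc r)).hasDerivWithinAt
        (s := Set.Ici 0)
    have h2 := (((hθd r hr).sin.const_mul e).smul (hGd r hr).hasDerivWithinAt)
    refine (h1.sub h2).congr_deriv ?_
    have h3 : toOp Y (pulledControl τ ε A B K ζ (max r 0)) = (e⁻¹ * cos (θ r)) • G r := by
      rw [max_eq_left hr, pulledControl, map_smul, esControl_of_nonneg hε hr]
      congr 1
      change act Y (act _ _) = _
      rw [← act_mul, hY, ← stateTransition_eq_mul hE]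
      rfl
    have h4 : e * (cos (θ r) * ((e ^ 2)⁻¹ + ν r)) = e⁻¹ * cos (θ r) + e * cos (θ r) * ν r := by
      field_simp
    rw [h3, h4]
    module
  have hwin : ∀ r, t - τ ≤ r → r ≤ t → |t - τ - r| ≤ τ := fun r h1 h2 => by
    rw [abs_le]; constructor <;> linarith
  have hGn : ∀ r, t - τ ≤ r → r ≤ t → ‖G r‖ ≤ φ * b := fun r h1 h2 =>
    (norm_act_le _ _).trans (mul_le_mul (hφ _ _ (hwin r h1 h2)) (hBb _ (by linarith))
      (norm_nonneg _) hφ0)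
  have hGn' : ∀ r, t - τ ≤ r → r ≤ t → ‖G' r‖ ≤ φ * (a * b + b') := fun r h1 h2 => by
    have h3 : ‖act (A (r + τ)) (B (r + τ))‖ ≤ a * b := (norm_act_le _ _).trans
      (mul_le_mul (hAb _) (hBb _ (by linarith)) (norm_nonneg _) ha)
    refine (norm_sub_le _ _).trans ((add_le_add ((norm_act_le _ _).trans (mul_le_mul
      (hφ _ _ (hwin r h1 h2)) (hB'b _ (by linarith)) (norm_nonneg _) hφ0)) ((norm_act_le _ _).trans
        (mul_le_mul (hφ _ _ (hwin r h1 h2)) h3 (norm_nonneg _) hφ0))).trans (le_of_eq ?_))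
    ring
  have hνn : ∀ r, t - τ ≤ r → r ≤ t → e * |ν r| ≤ e * (2 * a * k * ρ ^ 2) + 2 * β * k * ρ := by
    intro r h1 h2
    have hz := hρ r h1 h2
    have hKz : ‖act K (ζ r)‖ ≤ k * ρ :=
      (norm_act_le _ _).trans (mul_le_mul hk hz (norm_nonneg _) hk0)
    have hAz : ‖act (A r) (ζ r)‖ ≤ a * ρ :=
      (norm_act_le _ _).trans (mul_le_mul (hAb r) hz (norm_nonneg _) ha)
    have c1 : |(inner ℝ (act (A r) (ζ r)) (act K (ζ r)) : ℝ)| ≤ (a * ρ) * (k * ρ) :=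
      (abs_real_inner_le_norm _ _).trans (mul_le_mul hAz hKz (norm_nonneg _) (by positivity))
    have c2 : |(inner ℝ (BNew τ A B r) (act K (ζ r)) : ℝ)| ≤ β * (k * ρ) :=
      (abs_real_inner_le_norm _ _).trans
        (mul_le_mul (hβ r (ht0.trans h1)) hKz (norm_nonneg _) hβ0)
    have c3 : |ν r| ≤ 2 * ((a * ρ) * (k * ρ)) + 2 * e⁻¹ * 1 * (β * (k * ρ)) := by
      refine (abs_add_le _ _).trans ?_
      rw [abs_mul, abs_mul, abs_mul, abs_mul, abs_two, abs_of_pos (inv_pos.2 he)]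
      gcongr
      exact abs_cos_le_one _
    refine (mul_le_mul_of_nonneg_left c3 he.le).trans (le_of_eq ?_)
    field_simp
  -- the mean value inequality replaces integration by parts: `dot B` need not be continuous
  have hmv := norm_image_sub_le_of_norm_deriv_right_le_segment (f := D)
    (f' := fun r => -((e * sin (θ r)) • G' r + (e * cos (θ r) * ν r) • G r)) (a := t - τ) (b := t)
    (C := e * (φ * (a * b + b')) + (e * (2 * a * k * ρ ^ 2) + 2 * β * k * ρ) * (φ * b))
    (fun r hr => (hDd r (ht0.trans hr.1)).continuousWithinAt.mono
      fun s hs => ht0.trans hs.1)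
    (fun r hr => (hDd r (ht0.trans hr.1)).mono (Set.Ici_subset_Ici.2 (ht0.trans hr.1)))
    (fun r hr => by
      rw [norm_neg]
      refine (norm_add_le _ _).trans (add_le_add ?_ ?_)
      · rw [norm_smul, Real.norm_eq_abs, abs_mul, abs_of_pos he, mul_assoc]
        exact mul_le_mul_of_nonneg_left ((mul_le_of_le_one_left (norm_nonneg _)
          (abs_sin_le_one _)).trans (hGn' r hr.1 hr.2.le)) he.le
      · rw [norm_smul, Real.norm_eq_abs, abs_mul, abs_mul, abs_of_pos he]
        refine mul_le_mul ?_ (hGn r hr.1 hr.2.le) (norm_nonneg _) (by positivity)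
        refine le_trans ?_ (hνn r hr.1 hr.2.le)
        rw [mul_assoc]
        exact mul_le_mul_of_nonneg_left (mul_le_of_le_one_left (abs_nonneg _)
          (abs_cos_le_one _)) he.le) t ⟨by linarith, le_rfl⟩
  rw [sub_sub_cancel] at hmv
  have hT : reductionTerm τ ε A B K ζ t =
      (D t - D (t - τ)) + ((e * sin (θ t)) • G t - (e * sin (θ (t - τ))) • G (t - τ)) := by
    rw [reductionTerm_eq hτ.le hε hA hB.continuousOn hζc (hτ.le.trans ht), max_eq_left ht0,
      act_vec_sub]
    simp only [hD]
    abel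
  have hS : ∀ r, t - τ ≤ r → r ≤ t → ‖(e * sin (θ r)) • G r‖ ≤ e * (φ * b) := fun r h1 h2 => by
    rw [norm_smul, Real.norm_eq_abs, abs_mul, abs_of_pos he, mul_assoc]
    exact mul_le_mul_of_nonneg_left ((mul_le_of_le_one_left (norm_nonneg _)
      (abs_sin_le_one _)).trans (hGn r h1 h2)) he.le
  rw [hT]
  refine (norm_add_le _ _).trans ?_
  have h5 := (norm_sub_le ((e * sin (θ t)) • G t) ((e * sin (θ (t - τ))) • G (t - τ))).trans
    (add_le_add (hS t (by linarith) le_rfl) (hS (t - τ) le_rfl (by linarith)))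
  linarith

/-- The reduction term is eventually of order `ε^{1/4}`, uniformly in `ε < 1`. -/
theorem exists_eventually_norm_reductionTerm_le (hτ : 0 < τ) (hA : Continuous A)
    (hAb : ∃ C, ∀ t, ‖A t‖ ≤ C) (hB : DifferentiableOn ℝ B (Set.Ici 0))
    (hBb : ∃ C, ∀ t, 0 ≤ t → ‖B t‖ ≤ C) (hB'b : ∃ C, ∀ t, 0 ≤ t → ‖dot B t‖ ≤ C)
    (hK : K.IsHermitian) {β : ℝ} (hβ : ∀ t, 0 ≤ t → ‖BNew τ A B t‖ ≤ β) {M : ℝ} (hM : 0 < M) :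
    ∃ c : ℝ, 0 < c ∧ ∀ ε : ℝ, 0 < ε → ε < 1 → ∀ ζ,
      (reducedData τ A B K q pLow pBar ABar).IsReducedSolution ε ζ →
        (∀ᶠ t in Filter.atTop, ‖ζ t‖ ≤ M * ε ^ (1 / 4 : ℝ)) →
        ∀ᶠ t in Filter.atTop, ‖reductionTerm τ ε A B K ζ t‖ ≤ c * ε ^ (1 / 4 : ℝ) := by
  obtain ⟨a, ha⟩ := hAb
  obtain ⟨b, hb⟩ := hBb
  obtain ⟨b', hb'⟩ := hB'b
  have hE : Continuous fun r => A (r + τ) := hA.comp (continuous_id.add continuous_const)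
  have ha0 : 0 ≤ a := (norm_nonneg _).trans (ha 0)
  have hb0 : 0 ≤ b := (norm_nonneg _).trans (hb 0 le_rfl)
  have hb'0 : 0 ≤ b' := (norm_nonneg _).trans (hb' 0 le_rfl)
  have hβ0 : 0 ≤ β := (norm_nonneg _).trans (hβ 0 le_rfl)
  set φ := ‖(1 : RMat n)‖ * exp (a * τ) with hφdef
  have hφ0 : 0 ≤ φ := by positivity
  have hφ : ∀ t s, |t - s| ≤ τ → ‖delayTransition τ A t s‖ ≤ φ := fun t s hts =>
    (norm_stateTransition_le hE (fun r => ha (r + τ)) t s).trans (mul_le_mul_of_nonneg_left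
      (exp_le_exp.2 (mul_le_mul_of_nonneg_left hts ha0)) (norm_nonneg _))
  refine ⟨2 * (φ * b) + (φ * (a * b + b') +
        (2 * a * ‖K‖ * M ^ 2 + 2 * β * ‖K‖ * M) * (φ * b)) * τ + 1, by positivity,
    fun ε hε hε1 ζ hζ hev => ?_⟩
  set η := ε ^ (1 / 4 : ℝ) with hη
  have hη0 : 0 < η := rpow_pos_of_pos hε _
  have hη1 : η ≤ 1 := rpow_le_one hε.le hε1.le (by norm_num)
  have he0 := oscAmplitude_pos hε
  have he : oscAmplitude ε ≤ η := by
    refine (ESData.oscAmplitude_le_sqrt hε.le).trans ?_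
    rw [sqrt_eq_rpow]
    exact rpow_le_rpow_of_exponent_ge hε hε1.le (by norm_num)
  obtain ⟨T, hT⟩ := Filter.eventually_atTop.1 hev
  filter_upwards [Filter.eventually_ge_atTop (T + τ), Filter.eventually_ge_atTop τ] with t ht1 ht2
  have h := norm_reductionTerm_le hτ hε hA hB hK ha hb hb' hβ le_rfl hφ hζ ht2
    (ρ := M * η) fun m hm _ => hT m (by linarith)
  refine h.trans ?_
  have hη2 : η ^ 2 ≤ 1 := pow_le_one₀ hη0.le hη1
  calc 2 * (oscAmplitude ε * (φ * b)) +
      (oscAmplitude ε * (φ * (a * b + b')) +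
        (oscAmplitude ε * (2 * a * ‖K‖ * (M * η) ^ 2) + 2 * β * ‖K‖ * (M * η)) * (φ * b)) * τ
      ≤ 2 * (η * (φ * b)) + (η * (φ * (a * b + b')) +
        (η * (2 * a * ‖K‖ * (M ^ 2 * 1)) + 2 * β * ‖K‖ * (M * η)) * (φ * b)) * τ := by
        rw [mul_pow]
        gcongr
    _ = (2 * (φ * b) + (φ * (a * b + b') +
        (2 * a * ‖K‖ * M ^ 2 + 2 * β * ‖K‖ * M) * (φ * b)) * τ) * η := by ring
    _ ≤ _ := mul_le_mul_of_nonneg_right (le_add_of_nonneg_right zero_le_one) hη0.le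

theorem limsup_enorm_le {F : Type*} [SeminormedAddGroup F] {f : ℝ → F} {C : ℝ}
    (h : ∀ᶠ t in Filter.atTop, ‖f t‖ ≤ C) :
    Filter.limsup (fun t => ‖f t‖ₑ) Filter.atTop ≤ ENNReal.ofReal C := by
  refine Filter.limsup_le_of_le (by isBoundedDefault) (h.mono fun t ht => ?_)
  rw [← ofReal_norm]
  exact ENNReal.ofReal_le_ofReal ht

end Asymptotics

/-! ### Stability of the delayed closed loop -/

theorem theorem2 {n : ℕ} (τ σ₀ : ℝ) (hτ : 0 < τ) (hσ₀ : 0 < σ₀)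
    (A : ℝ → RMat n) (B : ℝ → RVec n)
    (hA : Continuous A) (hAb : ∃ C, ∀ t, ‖A t‖ ≤ C)
    (hB : DifferentiableOn ℝ B (Set.Ici 0)) (hBb : ∃ C, ∀ t, 0 ≤ t → ‖B t‖ ≤ C)
    (hB'b : ∃ C, ∀ t, 0 ≤ t → ‖dot B t‖ ≤ C)
    (K : RMat n) (P : ℝ → RMat n) (q pLow pBar pBarBar ABar : ℝ)
    (hplant : (reducedData τ A B K q pLow pBar ABar).PlantBounds)
    (hlyap : (reducedData τ A B K q pLow pBar ABar).LyapunovBounds P pBarBar) :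
    (∀ ε : ℝ, 0 < ε → (reducedData τ A B K q pLow pBar ABar).SmallParameter σ₀ ε →
      ∀ x₀ : RVec n, ‖x₀‖ ≤ σ₀ →
        (∃ x ζ : ℝ → RVec n, IsClosedLoopSolution τ ε A B K x ζ ∧ x 0 = x₀) ∧
        ∀ x ζ : ℝ → RVec n, IsClosedLoopSolution τ ε A B K x ζ → x 0 = x₀ →
          ∀ ξ₀ : ℝ,
            max ((reducedData τ A B K q pLow pBar ABar).xiS ε)
              ((reducedData τ A B K q pLow pBar ABar).initBound σ₀ ε) < ξ₀ →
            ξ₀ < (reducedData τ A B K q pLow pBar ABar).xiL ε →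
            ∀ t : ℝ, 0 ≤ t →
              ‖x t‖ ≤ (reducedData τ A B K q pLow pBar ABar).stateBound ε ξ₀ t
                + ‖reductionTerm τ ε A B K ζ t‖) ∧
    (∃ cT dT : ℝ, 0 < cT ∧ 0 < dT ∧
      ∀ ε : ℝ, 0 < ε → ε < 1 →
        (reducedData τ A B K q pLow pBar ABar).SmallParameter σ₀ ε →
        ∀ x ζ : ℝ → RVec n, IsClosedLoopSolution τ ε A B K x ζ → ‖x 0‖ ≤ σ₀ →
          Filter.limsup (fun t => ‖reductionTerm τ ε A B K ζ t‖ₑ) Filter.atTop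
              ≤ ENNReal.ofReal (cT * ε ^ (1 / 4 : ℝ)) ∧
          Filter.limsup (fun t => ‖x t‖ₑ) Filter.atTop
              ≤ ENNReal.ofReal (dT * ε ^ (1 / 4 : ℝ))) := by
  have hB0 := hB.continuousOn
  have hBn := hplant.differentiableOn_B.continuousOn
  obtain ⟨M, hM0, hM⟩ := ESData.exists_eventually_norm_le rfl hplant hlyap σ₀
  obtain ⟨cT, hcT0, hcT⟩ := exists_eventually_norm_reductionTerm_le (q := q) (pLow := pLow)
    (pBar := pBar) (ABar := ABar) hτ hA hAb hB hBb hB'b hlyap.posDef_K.isHermitian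
    hplant.norm_B_le hM0
  refine ⟨fun ε hε hs x₀ hx₀ => ⟨?_, fun x ζ hsol h0 ξ₀ hξ₀ hξ₁ t ht => ?_⟩,
    cT, M + cT, hcT0, by positivity, fun ε hε hε1 hs x ζ hsol h0 => ?_⟩
  · obtain ⟨ζ, hζ, hζ0⟩ := ESData.exists_isReducedSolution hplant hε x₀
    have hζc : ContinuousOn ζ (Set.Ici 0) := fun t ht => (hζ t ht).continuousWithinAt
    refine ⟨_, ζ, hζ.isClosedLoopSolution hτ hε hA hB0, ?_⟩
    simp only [reductionTerm_zero hτ.le hε hA hB0 hζc, sub_zero, hζ0]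
  · have hζ := hsol.isReducedSolution (q := q) (pLow := pLow) (pBar := pBar) (ABar := ABar)
      hτ hε hA hB0 hBn
    have hζ0 : ‖ζ 0‖ ≤ σ₀ := by rwa [hsol.zeta_zero hτ hε hA hB0, h0]
    have h1 := hζ.norm_le_stateBound rfl hplant hlyap hε hs hζ0 hξ₀ hξ₁ ht
    have h2 : x t = ζ t - reductionTerm τ ε A B K ζ t := by rw [hsol.zeta_eq t ht]; abel
    rw [h2]
    exact (norm_sub_le _ _).trans (add_le_add h1 le_rfl)
  · have hζ := hsol.isReducedSolution (q := q) (pLow := pLow) (pBar := pBar) (ABar := ABar)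
      hτ hε hA hB0 hBn
    have hζ0 : ‖ζ 0‖ ≤ σ₀ := by rwa [hsol.zeta_zero hτ hε hA hB0]
    have h1 := hM ε hε hε1 hs ζ hζ hζ0
    have h2 := hcT ε hε hε1 ζ hζ h1
    refine ⟨limsup_enorm_le h2, limsup_enorm_le ?_⟩
    filter_upwards [h1, h2, Filter.eventually_ge_atTop 0] with t ht1 ht2 ht
    have h3 : x t = ζ t - reductionTerm τ ε A B K ζ t := by rw [hsol.zeta_eq t ht]; abel
    rw [h3, add_mul]
    exact (norm_sub_le _ _).trans (add_le_add ht1 ht2)
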